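/- For an integer $T\ge 1$ let $\Psi_T=\frac1{\sqrt T}\sum_{i=0}^{T-1}|i\rangle^A|i\rangle^B$, and for a (mixed) state $\rho$ on $\mathcal H_T^A\otimes\mathcal H_T^B$ let its fidelity be $F(\rho)=\langle\Psi_T|\rho|\Psi_T\rangle$. A general entanglement purification protocol (GEPP) $\mathcal P$ with dimensions $N,K,M$ is a protocol of local operations and classical communication in which Alice and Bob share an input state $\rho$ on $\mathcal H_N^A\otimes\mathcal H_N^B$ and the auxiliary state $\Psi_K$, and end either by announcing $\mathsf{FAIL}$ or by outputting a state $\mathcal P(\rho)$ on $\mathcal H_M^A\otimes\mathcal H_M^B$; $\mathcal P(\rho)$ is a random variable, depending on all random choices and measurement outcomes. The protocol is probabilistically conditionally successful with parameter $\langle N,K,M,\epsilon,\delta,p,q\rangle$ if for every input state $\rho$ with $F(\rho)\ge 1-\epsilon$ (in particular for every one with $F(\rho)=1-\epsilon$) $$\Pr[\mathcal P(\rho)=\mathsf{FAIL}]\le p\quad\text{and}\quad \Pr[F(\mathcal P(\rho))\ge 1-\delta\mid \mathcal P(\rho)\ne\mathsf{FAIL}]\ge 1-q .$$ A family of such protocols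 is efficient if there are constants $C,c$ such that every member is implemented by quantum circuits of size at most $C(\log_2 N+\log_2 K)^c$. **Theorem.** For all integers $n>t\ge 0$ and $d\ge 1$ and all real $\epsilon<1/2$ there exist efficient probabilistically conditionally successful GEPPs (for arbitrary input states) with each of the following parameters; in each of the three families the constants $C,c$ do not depend on $n,t,d,\epsilon$: 1. $\left\langle 2^n,\ (2^n-1)2^{2t},\ 2^{n-t}(2^n-1),\ \epsilon,\ \frac{\epsilon}{2^{t-3}},\ 2\epsilon+\sqrt{\frac{2\epsilon}{2^t}},\ \frac1{2^t}\right\rangle$; 2. $\left\langle 2^{2n},\ (2^n+1)2^{2t},\ 2^{n}(2^n+1),\ \epsilon,\ \frac{\epsilon}{2^{t-3}},\ 2\epsilon+\sqrt{\frac{2\epsilon}{2^t}},\ \frac1{2^t}\right\rangle$; 3. $\left\langle 2^{dn},\ \frac{2^{dn}-1}{2^n-1}\cdot 2^{2t},\ 2^{(d-1)n}\cdot\frac{2^{dn}-1}{2^n-1},\ \epsilon,\ \frac{\epsilon}{2^{t-3}},\ 2\epsilon+\sqrt{\frac{2\epsilon}{2^t}},\ \frac1{2^t}\right\rangle$. 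-/

import Mathlib

open scoped Kronecker Matrix ComplexOrder

/-! ### Bipartite states and fidelity -/

/-- A (mixed) state: a density matrix. -/
def IsState {ι : Type*} [Fintype ι] (ρ : Matrix ι ι ℂ) : Prop :=
  ρ.PosSemidef ∧ ρ.trace = 1

/-- The maximally entangled vector `Ψ_T = T^(-1/2) ∑ i, |i⟩|i⟩`. -/
noncomputable def maxEnt (T : ℕ) : Fin T × Fin T → ℂ :=
  fun p => if p.1 = p.2 then ((1 / Real.sqrt T : ℝ) : ℂ) else 0

/-- The fidelity `⟨Ψ_T| ρ |Ψ_T⟩` of a bipartite state. -/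
noncomputable def fidelity {T : ℕ} (ρ : Matrix (Fin T × Fin T) (Fin T × Fin T) ℂ) : ℝ :=
  (star (maxEnt T) ⬝ᵥ (ρ *ᵥ maxEnt T)).re

/-! ### Circuits of one party on `w` qubits -/

/-- Computational basis labels of `w` qubits. -/
abbrev Qubits (w : ℕ) : Type := Fin w → Bool

/-- Elementary gates: NOT, Hadamard, the phase gate `T = diag(1, e^{iπ/4})`,
CNOT (control, target) and Toffoli (control, control, target). -/
inductive Gate (w : ℕ) : Type
  | not (i : Fin w) : Gate w
  | had (i : Fin w) : Gate w
  | phase (i : Fin w) : Gate w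
  | cnot (i j : Fin w) (hij : i ≠ j) : Gate w
  | toffoli (i j k : Fin w) (hij : i ≠ j) (hik : i ≠ k) (hjk : j ≠ k) : Gate w

/-- The operator `|y⟩ ↦ |f y⟩`. -/
def basisMap {w : ℕ} (f : Qubits w → Qubits w) : Matrix (Qubits w) (Qubits w) ℂ :=
  fun x y => if x = f y then 1 else 0

/-- The unitary matrix of a gate. -/
noncomputable def Gate.toMatrix {w : ℕ} : Gate w → Matrix (Qubits w) (Qubits w) ℂ
  | .not i => basisMap fun y => Function.update y i (!(y i))
  | .had i => fun x y =>
      if ∀ j, j ≠ i → x j = y j then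
        (if (x i && y i) = true then -1 else 1) * ((1 / Real.sqrt 2 : ℝ) : ℂ)
      else 0
  | .phase i => Matrix.diagonal fun x =>
      if x i = true then Complex.exp (Complex.I * (Real.pi / 4 : ℝ)) else 1
  | .cnot i j _ => basisMap fun y => Function.update y j (xor (y j) (y i))
  | .toffoli i j k _ _ _ => basisMap fun y => Function.update y k (xor (y k) (y i && y j))

/-- The projector onto the states whose qubit `i` has the value `b`. -/
def proj {w : ℕ} (i : Fin w) (b : Bool) : Matrix (Qubits w) (Qubits w) ℂ :=
  Matrix.diagonal fun x => if x i = b then 1 else 0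

/-! ### Two-party protocols: local operations and classical communication -/

inductive Party : Type
  | alice
  | bob

/-- Operators on the joint space of Alice's `w` qubits and Bob's `w` qubits. -/
abbrev JointOp (w : ℕ) : Type :=
  Matrix (Qubits w × Qubits w) (Qubits w × Qubits w) ℂ

/-- The product operator in which the named party applies `U` and the other one `V`. -/
def localOp {w : ℕ} (P : Party) (U V : Matrix (Qubits w) (Qubits w) ℂ) : JointOp w :=
  match P with
  | .alice => U ⊗ₖ V
  | .bob => V ⊗ₖ U

/-- One step of a protocol.
* `gate P g`: party `P` applies the gate `g` to its own qubits.
* `measure P i`: party `P` measures its qubit `i` in the computational basis.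
* `send P i j`: party `P` measures its qubit `i` in the computational basis and sends the
  resulting classical bit to the other party, who applies NOT to its own qubit `j` if the bit
  is `1` (so a qubit `j` in the state `|0⟩` stores the received bit).
Randomness is obtained by measuring ancillas. -/
inductive Step (w : ℕ) : Type
  | gate (P : Party) (g : Gate w) : Step w
  | measure (P : Party) (i : Fin w) : Step w
  | send (P : Party) (i j : Fin w) : Step w

/-- The operators of a step, one for each possible measurement outcome. -/
noncomputable def Step.ops {w : ℕ} : Step w → List (JointOp w)
  | .gate P g => [localOp P g.toMatrix 1]
  | .measure P i => [localOp P (proj i false) 1, localOp P (proj i true) 1]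
  | .send P i j =>
      [localOp P (proj i false) 1, localOp P (proj i true) (Gate.not j).toMatrix]

/-- The list, over all sequences of measurement outcomes, of the unnormalized states after the
program was run on `σ`; the trace of an entry is the probability of its sequence. -/
noncomputable def branches {w : ℕ} : List (Step w) → JointOp w → List (JointOp w)
  | [], σ => [σ]
  | s :: l, σ => s.ops.flatMap fun A => branches l (A * σ * Aᴴ)

/-- The `k`-bit binary representation of `x`. -/
def bits (k x : ℕ) : Fin k → Bool := fun i => x.testBit i

/-- A protocol that takes a state of dimension `N × N` and the auxiliary state `Ψ_K` and
outputs `FAIL` or a state of dimension `M × M`. Each party holds `width` qubits. Its parts of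
the input and of the auxiliary state are stored in binary on the wires `inWire` and `auxWire`,
the other qubits start as `|0⟩`. In the end Alice measures her qubit `failWire` and announces
the result, `1` meaning `FAIL`; otherwise the qubits on the wires `outWire` are the output and
all other qubits are discarded. -/
structure Protocol (N K M : ℕ) where
  width : ℕ
  wires : Fin (Nat.clog 2 N) ⊕ Fin (Nat.clog 2 K) ↪ Fin width
  outWire : Fin (Nat.clog 2 M) ↪ Fin width
  failWire : Fin width
  program : List (Step width)

namespace Protocol

variable {N K M : ℕ}

/-- The circuit size: the number of operations plus the number of qubits of both parties. -/
def size (P : Protocol N K M) : ℕ := P.program.length + 2 * P.width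

/-- One party's initial basis label when its input is `x` and its auxiliary input is `y`. -/
noncomputable def load (P : Protocol N K M) (x : Fin N) (y : Fin K) : Qubits P.width :=
  Function.extend P.wires
    (Sum.elim (bits (Nat.clog 2 N) x) (bits (Nat.clog 2 K) y)) (fun _ => false)

/-- The isometry that stores input and auxiliary input in the qubits. -/
noncomputable def loadOp (P : Protocol N K M) :
    Matrix (Qubits P.width × Qubits P.width) ((Fin N × Fin N) × (Fin K × Fin K)) ℂ :=
  fun q r => if q = (P.load r.1.1 r.2.1, P.load r.1.2 r.2.2) then 1 else 0

/-- The initial joint state: `ρ ⊗ |Ψ_K⟩⟨Ψ_K|` and ancillas `|0⟩`. -/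
noncomputable def initial (P : Protocol N K M) (ρ : Matrix (Fin N × Fin N) (Fin N × Fin N) ℂ) :
    JointOp P.width :=
  P.loadOp * (ρ ⊗ₖ Matrix.vecMulVec (maxEnt K) (star (maxEnt K))) * P.loadOpᴴ

/-- `a` has the binary representation of `x` on the output wires. -/
def Reads (P : Protocol N K M) (a : Qubits P.width) (x : Fin M) : Prop :=
  ∀ i, a (P.outWire i) = bits (Nat.clog 2 M) x i

/-- `a` and `a'` agree on all discarded wires. -/
def AgreeOff (P : Protocol N K M) (a a' : Qubits P.width) : Prop :=
  ∀ i, i ∉ Set.range P.outWire → a i = a' i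

open Classical in
/-- The (unnormalized) state of the output wires: the partial trace over all other wires, as a
matrix on the basis `|x⟩|y⟩` with `x, y < M`. -/
noncomputable def readOut (P : Protocol N K M) (σ : JointOp P.width) :
    Matrix (Fin M × Fin M) (Fin M × Fin M) ℂ :=
  fun r s => ∑ q : Qubits P.width × Qubits P.width, ∑ q' : Qubits P.width × Qubits P.width,
    if P.Reads q.1 r.1 ∧ P.Reads q.2 r.2 ∧ P.Reads q'.1 s.1 ∧ P.Reads q'.2 s.2 ∧
        P.AgreeOff q.1 q'.1 ∧ P.AgreeOff q.2 q'.2 then σ q q' else 0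

/-- What the protocol ends with: its probability, and `none` for `FAIL` or `some τ` for the
output state `τ`. -/
abbrev Result (M : ℕ) : Type := ℝ × Option (Matrix (Fin M × Fin M) (Fin M × Fin M) ℂ)

/-- The two results, `FAIL` and success, of a final joint state. -/
noncomputable def finish (P : Protocol N K M) (σ : JointOp P.width) : List (Result M) :=
  let E (b : Bool) : JointOp P.width := localOp .alice (proj P.failWire b) 1
  let bad := E true * σ * (E true)ᴴ
  let good := E false * σ * (E false)ᴴ
  [(bad.trace.re, none), (good.trace.re, some (good.trace⁻¹ • P.readOut good))]

/-- The random variable `P(ρ)`, listed over all sequences of measurement outcomes. Each listed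
output state is the state conditioned on the whole sequence. -/
noncomputable def results (P : Protocol N K M)
    (ρ : Matrix (Fin N × Fin N) (Fin N × Fin N) ℂ) : List (Result M) :=
  (branches P.program (P.initial ρ)).flatMap P.finish

open Classical in
/-- The probability of an event about `P(ρ)`. -/
noncomputable def prob (P : Protocol N K M) (ρ : Matrix (Fin N × Fin N) (Fin N × Fin N) ℂ)
    (E : Option (Matrix (Fin M × Fin M) (Fin M × Fin M) ℂ) → Prop) : ℝ :=
  ((P.results ρ).map fun r => if E r.2 then r.1 else 0).sum

/-- Whenever the protocol does not fail, it outputs a state of dimension `M × M`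
(no weight on binary numbers that are at least `M`). -/
def IsGEPP (P : Protocol N K M) : Prop :=
  ∀ ρ, IsState ρ → ∀ r ∈ P.results ρ, r.1 ≠ 0 → ∀ τ, r.2 = some τ → IsState τ

/-- Probabilistically conditionally successful with parameter `⟨N, K, M, ε, δ, p, q⟩`: on every
input of fidelity at least `1 - ε` the protocol fails with probability at most `p`, and,
conditioned on not failing, it outputs a state of fidelity at least `1 - δ` with probability at
least `1 - q`. The conditional probability is multiplied out, so that the second condition is
void if failure is certain. -/
def ProbSuccessful (P : Protocol N K M) (ε δ p q : ℝ) : Prop :=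
  P.IsGEPP ∧ ∀ ρ, IsState ρ → 1 - ε ≤ fidelity ρ →
    P.prob ρ (fun r => r = none) ≤ p ∧
    (1 - q) * P.prob ρ (fun r => r ≠ none) ≤
      P.prob ρ (fun r => ∃ τ, r = some τ ∧ 1 - δ ≤ fidelity τ)

end Protocol

/-- The protocol has size at most `C (log N + log K)^c`. -/
def SizeBound {N K M : ℕ} (P : Protocol N K M) (C c : ℕ) : Prop :=
  (P.size : ℝ) ≤ C * (Real.logb 2 N + Real.logb 2 K) ^ c

/-! The protocol tests the input with random stabilizer measurements. In binary, `Ψ_K` with `K = L *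
2^(2t)` is a product of `2t` EPR pairs on the low-order wires and `Ψ_L` on the others. Each EPR pair
is spent on measuring one observable `P = Z^v X^u ⊗ Z^v X^u` on the input, with `u`, `v` uniformly
random. Since `Z^v X^u` is real, `P` is an involution that fixes the maximally entangled vector.
Alice announces failure if any outcome is `-1`. The output consists of `Ψ_L` and some of the input
pairs.

The average of `P` over all `u`, `v` is the projector onto the maximally entangled vector
(`sum_innerAmp_pauli`). So on average the projection `(1 + P) / 2` keeps the weight on that vector
and halves the weight orthogonal to it (`overlap_checked`, `expand_passed_normSqAmp`). For an input
of fidelity `F`, all checks pass with probability `F + (1 - F) / 4^t`, and `(1 - F) / 4^t` of this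
is orthogonal weight (`expand_some`, `expand_deficit`). Failure thus has probability at most `1 - F
≤ ε`. By Markov's inequality with threshold `δ = 8ε / 2^t`, passing with infidelity above `δ` has
probability at most `1 / (8 * 2^t)`. Passing itself has probability at least `1/2`, which gives the
conditional bound. Discarding input pairs does not lower the fidelity (`fidelity_readOut_stage`), so
the three families differ only in the choice of the input size, of `L` and of the number of kept
pairs.

The link with circuits is an invariant. States are written `ψ * ψᴴ`, and `total` sums a quantity
over all branches. After `k` checks every branch has the form `stage`: classical records, correlated
unused auxiliary wires, and an amplitude function `χ` on the input. A check with outcome `s`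
replaces `χ` by a multiple of `χ ± Pχ` (`total_check`), so statements about all branches become
statements about the recursion `expand` on amplitudes (`total_checks`). -/

/-- The sign `(-1)^c`. -/
def sgn (c : Bool) : ℂ := if c then -1 else 1

/-- Add the bit `c` to wire `i`. -/
def xorAt {w : ℕ} (i : Fin w) (c : Bool) (a : Qubits w) : Qubits w :=
  Function.update a i (xor (a i) c)

/-! ### Action of single steps on amplitudes -/

section Operators

variable {w : ℕ} {X : Type*}

lemma localOp_alice_mul_apply (U : Matrix (Qubits w) (Qubits w) ℂ)
    (ψ : Matrix (Qubits w × Qubits w) X ℂ) (a b : Qubits w) (x : X) :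
    (localOp .alice U 1 * ψ) (a, b) x = ∑ a', U a a' * ψ (a', b) x := by
  simp only [localOp, Matrix.mul_apply, Fintype.sum_prod_type, Matrix.kroneckerMap_apply,
    Matrix.one_apply, mul_ite, mul_one, mul_zero, ite_mul, zero_mul, Finset.sum_ite_eq,
    Finset.mem_univ, if_true]

lemma localOp_bob_mul_apply (U V : Matrix (Qubits w) (Qubits w) ℂ)
    (ψ : Matrix (Qubits w × Qubits w) X ℂ) (a b : Qubits w) (x : X) :
    (localOp .bob U V * ψ) (a, b) x = ∑ a', ∑ b', V a a' * U b b' * ψ (a', b') x := by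
  simp only [localOp, Matrix.mul_apply, Fintype.sum_prod_type, Matrix.kroneckerMap_apply]

lemma localOp_mul_apply (U V : Matrix (Qubits w) (Qubits w) ℂ)
    (ψ : Matrix (Qubits w × Qubits w) X ℂ) (a b : Qubits w) (x : X) :
    (localOp .alice U V * ψ) (a, b) x = ∑ a', ∑ b', U a a' * V b b' * ψ (a', b') x := by
  simp only [localOp, Matrix.mul_apply, Fintype.sum_prod_type, Matrix.kroneckerMap_apply]

lemma sum_basisMap {f : Qubits w → Qubits w} (hf : Function.Involutive f)
    (g : Qubits w → ℂ) (a : Qubits w) : ∑ a', basisMap f a a' * g a' = g (f a) := by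
  have : ∀ a', basisMap f a a' * g a' = if a' = f a then g a' else 0 := by
    intro a'
    by_cases h : a' = f a
    · simp [basisMap, h, hf a]
    · have : a ≠ f a' := fun h' => h (by rw [h', hf])
      simp [basisMap, h, this]
  simp [this]

lemma sum_proj (i : Fin w) (c : Bool) (g : Qubits w → ℂ) (a : Qubits w) :
    ∑ a', proj i c a a' * g a' = if a i = c then g a else 0 := by
  simp [proj, Matrix.diagonal_apply]

lemma sum_one (g : Qubits w → ℂ) (a : Qubits w) :
    ∑ a', (1 : Matrix (Qubits w) (Qubits w) ℂ) a a' * g a' = g a := by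
  simp [Matrix.one_apply]

lemma sum_had (i : Fin w) (g : Qubits w → ℂ) (a : Qubits w) :
    ∑ a', (Gate.had i).toMatrix a a' * g a' =
      ((1 / Real.sqrt 2 : ℝ) : ℂ) * ∑ c, sgn (a i && c) * g (Function.update a i c) := by
  have hinj : Function.Injective fun c => Function.update a i c := Function.update_injective a i
  rw [Finset.mul_sum]
  symm
  apply Fintype.sum_of_injective _ hinj
  · intro a' ha'
    have : ¬ ∀ j, j ≠ i → a j = a' j := by
      intro h
      apply ha'
      refine ⟨a' i, ?_⟩
      ext j
      by_cases hj : j = i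
      · subst hj; simp
      · simp [hj, h j hj]
    simp only [Gate.toMatrix, this, if_false, zero_mul]
  · intro c
    have : ∀ j, j ≠ i → a j = Function.update a i c j := by
      intro j hj; simp [hj]
    rw [Gate.toMatrix]
    beta_reduce
    rw [if_pos this]
    simp only [Function.update_self, sgn]
    ring

lemma xorAt_apply (i : Fin w) (c : Bool) (a : Qubits w) (j : Fin w) :
    xorAt i c a j = if j = i then xor (a i) c else a j := by
  by_cases h : j = i
  · subst h; simp [xorAt]
  · simp [xorAt, h]

lemma xorAt_self (i : Fin w) (c : Bool) (a : Qubits w) : xorAt i c a i = xor (a i) c := by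
  simp [xorAt]

lemma xorAt_of_ne {i j : Fin w} (h : j ≠ i) (c : Bool) (a : Qubits w) : xorAt i c a j = a j := by
  simp [xorAt, h]

lemma xorAt_false (i : Fin w) (a : Qubits w) : xorAt i false a = a := by
  ext j; simp [xorAt_apply]; rintro rfl; rfl

lemma xorAt_xorAt (i : Fin w) (c d : Bool) (a : Qubits w) :
    xorAt i c (xorAt i d a) = xorAt i (xor d c) a := by
  ext j; by_cases h : j = i <;> simp [xorAt_apply, h]

/-- The permutations of the basis induced by the classical gates. -/
def Gate.perm : Gate w → Qubits w → Qubits w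
  | .not i => fun a => xorAt i true a
  | .had _ => id
  | .phase _ => id
  | .cnot i j _ => fun a => xorAt j (a i) a
  | .toffoli i j k _ _ _ => fun a => xorAt k (a i && a j) a

/-- The gate permutes the computational basis. -/
def Gate.Classical : Gate w → Prop
  | .had _ => False
  | .phase _ => False
  | _ => True

lemma Gate.Classical.toMatrix {g : Gate w} (h : g.Classical) :
    g.toMatrix = basisMap g.perm := by
  cases g <;> first | exact h.elim | rfl | skip
  simp [Gate.toMatrix, Gate.perm, xorAt]

lemma Gate.perm_involutive (g : Gate w) : Function.Involutive g.perm := by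
  intro a
  cases g with
  | not i => simp [Gate.perm, xorAt_xorAt, xorAt_false]
  | had i => rfl
  | phase i => rfl
  | cnot i j h => simp [Gate.perm, xorAt_of_ne h, xorAt_xorAt, xorAt_false]
  | toffoli i j k h1 h2 h3 =>
    simp [Gate.perm, xorAt_of_ne h2, xorAt_of_ne h3, xorAt_xorAt, xorAt_false]

variable [Fintype X]

/-- The sum of `Φ` over the final states of all branches of a program run on the mixture of the
columns of `ψ`. -/
noncomputable def total {β : Type*} [AddCommMonoid β] (l : List (Step w))
    (ψ : Matrix (Qubits w × Qubits w) X ℂ) (Φ : JointOp w → β) : β :=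
  ((branches l (ψ * ψᴴ)).map Φ).sum

variable {β : Type*} [AddCommMonoid β]

lemma total_nil (ψ : Matrix (Qubits w × Qubits w) X ℂ) (Φ : JointOp w → β) :
    total [] ψ Φ = Φ (ψ * ψᴴ) := by
  simp [total, branches]

/-- Conjugation by `A` acts on a factor, `A (ψ ψᴴ) Aᴴ = (A ψ) (A ψ)ᴴ`, so a program can be followed
on `ψ` alone. -/
lemma total_cons (s : Step w) (l : List (Step w)) (ψ : Matrix (Qubits w × Qubits w) X ℂ)
    (Φ : JointOp w → β) :
    total (s :: l) ψ Φ = (s.ops.map fun A => total l (A * ψ) Φ).sum := by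
  have : ∀ A : JointOp w, A * (ψ * ψᴴ) * Aᴴ = (A * ψ) * (A * ψ)ᴴ := by
    intro A; simp only [Matrix.conjTranspose_mul, Matrix.mul_assoc]
  simp only [total, branches, this]
  induction s.ops with
  | nil => simp
  | cons A t ih =>
    simp only [List.flatMap_cons, List.map_append, List.sum_append, ih, List.map_cons,
      List.sum_cons]

/-- The new amplitude at a label is the old one at its preimage, and the preimage is `perm` itself
because the gate is an involution. Successive gates therefore compose backwards, the last gate
acting on the label first. -/
lemma total_classical_alice {g : Gate w} (hg : g.Classical) (l : List (Step w))
    (ψ : Matrix (Qubits w × Qubits w) X ℂ) (Φ : JointOp w → β) :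
    total (.gate .alice g :: l) ψ Φ =
      total l (Matrix.of fun p x => ψ (g.perm p.1, p.2) x) Φ := by
  simp only [total_cons, Step.ops, List.map_cons, List.map_nil, List.sum_cons, List.sum_nil,
    add_zero]
  congr 1
  ext ⟨a, b⟩ x
  rw [localOp_alice_mul_apply, hg.toMatrix, sum_basisMap g.perm_involutive (fun a' => ψ (a', b) x)]
  rfl

lemma total_classical_bob {g : Gate w} (hg : g.Classical) (l : List (Step w))
    (ψ : Matrix (Qubits w × Qubits w) X ℂ) (Φ : JointOp w → β) :
    total (.gate .bob g :: l) ψ Φ =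
      total l (Matrix.of fun p x => ψ (p.1, g.perm p.2) x) Φ := by
  simp only [total_cons, Step.ops, List.map_cons, List.map_nil, List.sum_cons, List.sum_nil,
    add_zero]
  congr 1
  ext ⟨a, b⟩ x
  simp only [localOp_bob_mul_apply, mul_assoc, ← Finset.mul_sum]
  rw [sum_one (fun a' => ∑ b', g.toMatrix b b' * ψ (a', b') x), hg.toMatrix,
    sum_basisMap g.perm_involutive (fun b' => ψ (a, b') x)]
  rfl

lemma total_had_alice (i : Fin w) (l : List (Step w))
    (ψ : Matrix (Qubits w × Qubits w) X ℂ) (Φ : JointOp w → β) :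
    total (.gate .alice (.had i) :: l) ψ Φ =
      total l (Matrix.of fun p x => ((1 / Real.sqrt 2 : ℝ) : ℂ) *
        ∑ c, sgn (p.1 i && c) * ψ (Function.update p.1 i c, p.2) x) Φ := by
  simp only [total_cons, Step.ops, List.map_cons, List.map_nil, List.sum_cons, List.sum_nil,
    add_zero]
  congr 1
  ext ⟨a, b⟩ x
  rw [localOp_alice_mul_apply, sum_had i (fun a' => ψ (a', b) x)]
  rfl

lemma total_had_bob (i : Fin w) (l : List (Step w))
    (ψ : Matrix (Qubits w × Qubits w) X ℂ) (Φ : JointOp w → β) :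
    total (.gate .bob (.had i) :: l) ψ Φ =
      total l (Matrix.of fun p x => ((1 / Real.sqrt 2 : ℝ) : ℂ) *
        ∑ c, sgn (p.2 i && c) * ψ (p.1, Function.update p.2 i c) x) Φ := by
  simp only [total_cons, Step.ops, List.map_cons, List.map_nil, List.sum_cons, List.sum_nil,
    add_zero]
  congr 1
  ext ⟨a, b⟩ x
  simp only [localOp_bob_mul_apply, mul_assoc, ← Finset.mul_sum]
  rw [sum_one (fun a' => ∑ b', (Gate.had i).toMatrix b b' * ψ (a', b') x),
    sum_had i (fun b' => ψ (a, b') x)]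
  rfl

lemma total_measure_alice (i : Fin w) (l : List (Step w))
    (ψ : Matrix (Qubits w × Qubits w) X ℂ) (Φ : JointOp w → β) :
    total (.measure .alice i :: l) ψ Φ =
      ∑ s, total l (Matrix.of fun p x => if p.1 i = s then ψ p x else 0) Φ := by
  have key : ∀ s, localOp .alice (proj i s) 1 * ψ =
      Matrix.of fun p x => if p.1 i = s then ψ p x else 0 := by
    intro s
    ext ⟨a, b⟩ x
    rw [localOp_alice_mul_apply, sum_proj i s (fun a' => ψ (a', b) x)]
    rfl
  simp only [total_cons, Step.ops, List.map_cons, List.map_nil, List.sum_cons, List.sum_nil,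
    add_zero, key, Fintype.sum_bool]
  exact add_comm _ _

lemma sum_not (i : Fin w) (g : Qubits w → ℂ) (a : Qubits w) :
    ∑ a', (Gate.not i).toMatrix a a' * g a' = g (xorAt i true a) := by
  rw [Gate.Classical.toMatrix (g := .not i) trivial, sum_basisMap (Gate.perm_involutive _)]
  rfl

lemma total_send_alice (i j : Fin w) (l : List (Step w))
    (ψ : Matrix (Qubits w × Qubits w) X ℂ) (Φ : JointOp w → β) :
    total (.send .alice i j :: l) ψ Φ =
      ∑ s, total l (Matrix.of fun p x => if p.1 i = s then ψ (p.1, xorAt j s p.2) x else 0) Φ := by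
  have h0 : localOp .alice (proj i false) 1 * ψ =
      Matrix.of fun p x => if p.1 i = false then ψ (p.1, xorAt j false p.2) x else 0 := by
    ext ⟨a, b⟩ x
    rw [localOp_alice_mul_apply, sum_proj i false (fun a' => ψ (a', b) x)]
    simp [xorAt_false]
  have h1 : localOp .alice (proj i true) (Gate.not j).toMatrix * ψ =
      Matrix.of fun p x => if p.1 i = true then ψ (p.1, xorAt j true p.2) x else 0 := by
    ext ⟨a, b⟩ x
    simp only [localOp_mul_apply, mul_assoc, ← Finset.mul_sum]
    rw [sum_proj i true (fun a' => ∑ b', (Gate.not j).toMatrix b b' * ψ (a', b') x),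
      sum_not j (fun b' => ψ (a, b') x)]
    rfl
  simp only [total_cons, Step.ops, List.map_cons, List.map_nil, List.sum_cons, List.sum_nil,
    add_zero, h0, h1, Fintype.sum_bool]
  exact add_comm _ _

lemma total_send_bob (i j : Fin w) (l : List (Step w))
    (ψ : Matrix (Qubits w × Qubits w) X ℂ) (Φ : JointOp w → β) :
    total (.send .bob i j :: l) ψ Φ =
      ∑ s, total l (Matrix.of fun p x => if p.2 i = s then ψ (xorAt j s p.1, p.2) x else 0) Φ := by
  have h0 : localOp .bob (proj i false) 1 * ψ =
      Matrix.of fun p x => if p.2 i = false then ψ (xorAt j false p.1, p.2) x else 0 := by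
    ext ⟨a, b⟩ x
    simp only [localOp_bob_mul_apply, mul_assoc, ← Finset.mul_sum]
    rw [sum_one (fun a' => ∑ b', proj i false b b' * ψ (a', b') x),
      sum_proj i false (fun b' => ψ (a, b') x)]
    simp [xorAt_false]
  have h1 : localOp .bob (proj i true) (Gate.not j).toMatrix * ψ =
      Matrix.of fun p x => if p.2 i = true then ψ (xorAt j true p.1, p.2) x else 0 := by
    ext ⟨a, b⟩ x
    simp only [localOp_bob_mul_apply, mul_assoc, ← Finset.mul_sum]
    rw [sum_not j (fun a' => ∑ b', proj i true b b' * ψ (a', b') x),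
      sum_proj i true (fun b' => ψ (xorAt j true a, b') x)]
    rfl
  simp only [total_cons, Step.ops, List.map_cons, List.map_nil, List.sum_cons, List.sum_nil,
    add_zero, h0, h1, Fintype.sum_bool]
  exact add_comm _ _

end Operators

/-! ### Blocks of gates: shared random strings, controlled Paulis, parities -/

lemma sgn_xor (c d : Bool) : sgn (xor c d) = sgn c * sgn d := by
  cases c <;> cases d <;> simp [sgn]

/-- Add the bit string `r` to the wires `ws`. -/
def shift {w m : ℕ} (ws : Fin m → Fin w) (r : Fin m → Bool) (a : Qubits w) : Qubits w :=
  fun i => xor (a i) (decide (∃ j, ws j = i ∧ r j = true))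

lemma shift_apply_mem {w m : ℕ} {ws : Fin m → Fin w} (hws : Function.Injective ws)
    (r : Fin m → Bool) (a : Qubits w) (j : Fin m) : shift ws r a (ws j) = xor (a (ws j)) (r j) := by
  simp [shift, hws.eq_iff]

lemma shift_apply_not_mem {w m : ℕ} {ws : Fin m → Fin w} (r : Fin m → Bool) (a : Qubits w)
    {i : Fin w} (hi : ∀ j, i ≠ ws j) : shift ws r a i = a i := by
  have : ¬ ∃ j, ws j = i ∧ r j = true := by
    rintro ⟨j, h, -⟩; exact hi j h.symm
  simp [shift, this]

lemma shift_cons {w m : ℕ} {ws : Fin (m + 1) → Fin w} (hws : Function.Injective ws) (c : Bool)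
    (r : Fin m → Bool) (a : Qubits w) :
    shift ws (Fin.cons c r) a = xorAt (ws 0) c (shift (fun j => ws j.succ) r a) := by
  have h0 : ∀ j : Fin m, ws 0 ≠ ws j.succ := fun j h => absurd (hws h) (Fin.succ_ne_zero j).symm
  ext i
  by_cases hi : i = ws 0
  · subst hi
    rw [shift_apply_mem hws, xorAt_self, shift_apply_not_mem _ _ h0]
    rfl
  · rw [xorAt_of_ne hi]
    by_cases h : ∃ j : Fin m, i = ws j.succ
    · obtain ⟨j, rfl⟩ := h
      have hinj : Function.Injective fun j : Fin m => ws j.succ :=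
        hws.comp (Fin.succ_injective _)
      rw [shift_apply_mem hws, shift_apply_mem hinj r a j]
      rfl
    · push Not at h
      rw [shift_apply_not_mem _ _ h, shift_apply_not_mem]
      intro j
      refine Fin.cases hi h j

/-- The sum of bits modulo 2. -/
def parity {m : ℕ} (c : Fin m → Bool) : Bool :=
  (List.finRange m).foldr (fun j d => xor d (c j)) false

lemma sgn_parity {m : ℕ} (c : Fin m → Bool) : sgn (parity c) = ∏ j, sgn (c j) := by
  rw [Fin.prod_univ_def, parity]
  induction List.finRange m with
  | nil => simp [sgn]
  | cons j t ih => simp [sgn_xor, ih, mul_comm]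

section Blocks

variable {w m : ℕ} {X : Type*} [Fintype X] {β : Type*} [AddCommMonoid β]

/-- A Hadamard on a zero wire followed by a measurement yields a uniform bit, which the send step
adds to Bob's wire. The probability `1/2` appears as the amplitude factor `1/√2`. -/
lemma total_sample_bit (i : Fin w) (l : List (Step w))
    (ψ : Matrix (Qubits w × Qubits w) X ℂ) (Φ : JointOp w → β)
    (hψ : ∀ a b x, a i = true → ψ (a, b) x = 0) :
    total (.gate .alice (.had i) :: .send .alice i i :: l) ψ Φ =
      ∑ c, total l (Matrix.of fun p x =>
        ((1 / Real.sqrt 2 : ℝ) : ℂ) * ψ (xorAt i c p.1, xorAt i c p.2) x) Φ := by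
  rw [total_had_alice, total_send_alice]
  refine Finset.sum_congr rfl fun c _ => ?_
  congr 1
  ext ⟨a, b⟩ x
  have h1 : ∀ b', ψ (Function.update a i true, b') x = 0 := fun b' => hψ _ _ _ (by simp)
  simp only [Matrix.of_apply, Fintype.sum_bool, h1, mul_zero, zero_add, Bool.and_false]
  by_cases h : a i = c
  · have : Function.update a i false = xorAt i c a := by
      simp [xorAt, h]
    simp [h, this, sgn]
  · rw [if_neg h, hψ _ _ _ _, mul_zero]
    rw [xorAt_self]
    revert h; cases a i <;> cases c <;> simp

/-- Alice samples a random bit for each wire in `ws` and tells it to Bob. -/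
def sample (ws : Fin m → Fin w) : List (Step w) :=
  (List.finRange m).flatMap fun j => [.gate .alice (.had (ws j)), .send .alice (ws j) (ws j)]

lemma total_sample {ws : Fin m → Fin w} (hws : Function.Injective ws) (l : List (Step w))
    (ψ : Matrix (Qubits w × Qubits w) X ℂ) (Φ : JointOp w → β)
    (hψ : ∀ a b x j, a (ws j) = true → ψ (a, b) x = 0) :
    total (sample ws ++ l) ψ Φ =
      ∑ r : Fin m → Bool, total l (Matrix.of fun p x =>
        ((1 / Real.sqrt 2 : ℝ) : ℂ) ^ m * ψ (shift ws r p.1, shift ws r p.2) x) Φ := by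
  induction m generalizing ψ with
  | zero =>
    have : ∀ r a, shift ws r a = a := by
      intro r a; ext i; exact shift_apply_not_mem _ _ fun j => j.elim0
    simp only [sample, List.finRange_zero, List.flatMap_nil, List.nil_append, this, pow_zero,
      one_mul, Finset.univ_unique, Finset.sum_const, Finset.card_singleton, one_smul]
    rfl
  | succ m ih =>
    have hinj : Function.Injective fun j : Fin m => ws j.succ := hws.comp (Fin.succ_injective _)
    have hs : sample ws = .gate .alice (.had (ws 0)) :: .send .alice (ws 0) (ws 0) ::
        sample fun j : Fin m => ws j.succ := by
      simp [sample, List.finRange_succ, List.flatMap_map]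
    rw [hs, List.cons_append, List.cons_append, total_sample_bit _ _ _ _ (fun a b x => hψ a b x 0),
      ← (Fin.consEquiv fun _ : Fin (m + 1) => Bool).sum_comp, Fintype.sum_prod_type]
    refine Finset.sum_congr rfl fun c _ => ?_
    rw [ih hinj]
    · refine Finset.sum_congr rfl fun r _ => ?_
      congr 1
      ext ⟨a, b⟩ x
      simp only [Matrix.of_apply, Fin.consEquiv, Equiv.coe_fn_mk, shift_cons hws]
      ring
    · intro a b x j hj
      simp only [Matrix.of_apply]
      rw [hψ _ _ _ j.succ, mul_zero]
      rw [xorAt_of_ne (fun h => absurd (hws h) (Fin.succ_ne_zero j))]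
      exact hj

/-- Both parties apply the gates `g j`. -/
def both (g : Fin m → Gate w) (js : List (Fin m)) : List (Step w) :=
  js.flatMap fun j => [.gate .alice (g j), .gate .bob (g j)]

lemma total_both {g : Fin m → Gate w} (hg : ∀ j, (g j).Classical) (js : List (Fin m))
    (l : List (Step w)) (ψ : Matrix (Qubits w × Qubits w) X ℂ) (Φ : JointOp w → β) :
    total (both g js ++ l) ψ Φ = total l (Matrix.of fun p x =>
      ψ (js.foldr (fun j => (g j).perm) p.1, js.foldr (fun j => (g j).perm) p.2) x) Φ := by
  induction js generalizing ψ with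
  | nil => rfl
  | cons j t ih =>
    have : both g (j :: t) ++ l = .gate .alice (g j) :: .gate .bob (g j) :: (both g t ++ l) := by
      simp [both]
    rw [this, total_classical_alice (hg j), total_classical_bob (hg j), ih]
    rfl

/-- No target is a control, so the Toffoli gates do not disturb each other and together apply `X^u`
controlled by `e`. -/
lemma foldr_toffoli_targets {inp u : Fin m → Fin w} (e : Fin w) (hinp : Function.Injective inp)
    (hu : ∀ j j', u j ≠ inp j') (he : ∀ j, e ≠ inp j) (a : Qubits w) :
    (List.finRange m).foldr (fun j a => xorAt (inp j) (a (u j) && a e) a) a =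
      shift inp (fun j => a (u j) && a e) a := by
  have key : ∀ js : List (Fin m), js.Nodup →
      (∀ i, (∀ j, i ≠ inp j) →
        js.foldr (fun j a => xorAt (inp j) (a (u j) && a e) a) a i = a i) ∧
      ∀ j, js.foldr (fun j a => xorAt (inp j) (a (u j) && a e) a) a (inp j) =
        if j ∈ js then xor (a (inp j)) (a (u j) && a e) else a (inp j) := by
    intro js
    induction js with
    | nil => simp
    | cons j t ih =>
      intro hnd
      obtain ⟨hj, ht⟩ := List.nodup_cons.1 hnd
      obtain ⟨h1, h2⟩ := ih ht
      refine ⟨fun i hi => ?_, fun j' => ?_⟩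
      · rw [List.foldr_cons, xorAt_of_ne (hi j), h1 i hi]
      · rw [List.foldr_cons, xorAt_apply]
        by_cases hjj : j' = j
        · subst hjj
          simp [h2, hj, h1 _ (hu j'), h1 _ he]
        · simp [hinp.eq_iff, hjj, h2]
  obtain ⟨h1, h2⟩ := key _ (List.nodup_finRange m)
  ext i
  by_cases h : ∃ j, i = inp j
  · obtain ⟨j, rfl⟩ := h
    rw [h2, shift_apply_mem hinp]; simp
  · push Not at h
    rw [h1 i h, shift_apply_not_mem _ _ h]

/-- The common target is never a control, so the contributions add up. After a Hadamard on `e`,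
adding this parity to `e` has the effect of a controlled `Z^v` before it. -/
lemma foldr_toffoli_controls {inp v : Fin m → Fin w} (e : Fin w)
    (hv : ∀ j, v j ≠ e) (he : ∀ j, inp j ≠ e) (a : Qubits w) :
    (List.finRange m).foldr (fun j a => xorAt e (a (v j) && a (inp j)) a) a =
      xorAt e (parity fun j => a (v j) && a (inp j)) a := by
  rw [parity]
  induction List.finRange m with
  | nil => simp [xorAt_false]
  | cons j t ih =>
    rw [List.foldr_cons, ih, xorAt_of_ne (hv j), xorAt_of_ne (he j), xorAt_xorAt]
    simp

end Blocks

/-! ### Wire layout and the invariant of the joint state -/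

/-- One party's wires: the input, the auxiliary input, and the ancillas, which are for each check
two random strings, and the syndromes accumulated so far. -/
abbrev Wire (nI nK T : ℕ) : Type :=
  (Fin nI ⊕ Fin nK) ⊕ ((Fin T × Fin nI) ⊕ (Fin T × Fin nI)) ⊕ Fin (T + 1)

abbrev numWires (nI nK T : ℕ) : ℕ := Fintype.card (Wire nI nK T)

section Checks

variable {nI nK T : ℕ}

noncomputable def wire : Wire nI nK T ≃ Fin (numWires nI nK T) := Fintype.equivFin _

noncomputable abbrev inW (j : Fin nI) : Fin (numWires nI nK T) := wire (.inl (.inl j))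
noncomputable abbrev auxW (i : Fin nK) : Fin (numWires nI nK T) := wire (.inl (.inr i))
noncomputable abbrev uW (k : Fin T) (j : Fin nI) : Fin (numWires nI nK T) :=
  wire (.inr (.inl (.inl (k, j))))
noncomputable abbrev vW (k : Fin T) (j : Fin nI) : Fin (numWires nI nK T) :=
  wire (.inr (.inl (.inr (k, j))))
noncomputable abbrev synW (k : Fin (T + 1)) : Fin (numWires nI nK T) := wire (.inr (.inr k))

/-- The `k`-th check: for random `u`, `v` the parties use the `k`-th auxiliary pair to measure
`Z^v X^u ⊗ Z^v X^u` on their input, and Alice records whether a check has failed so far. -/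
noncomputable def check (hT : T ≤ nK) (k : Fin T) : List (Step (numWires nI nK T)) :=
  let e : Fin (numWires nI nK T) := auxW (k.castLE hT)
  sample (uW k) ++ (sample (vW k) ++
    (both (fun j => .toffoli (uW k j) e (inW j) (by simp [e]) (by simp) (by simp [e]))
      (List.finRange nI) ++
    (.gate .alice (.had e) :: .gate .bob (.had e) ::
    (both (fun j => .toffoli (vW k j) (inW j) e (by simp) (by simp [e]) (by simp [e]))
      (List.finRange nI) ++
    [.send .bob e e, .measure .alice e,
      .gate .alice (.cnot (synW k.castSucc) (synW k.succ) (by simp [Fin.ext_iff])),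
      .gate .alice (.cnot e (synW k.succ) (by simp [e])),
      .gate .alice (.toffoli (synW k.castSucc) e (synW k.succ) (by simp [e])
        (by simp [Fin.ext_iff]) (by simp [e]))]))))

/-- When `k` checks are done: the used auxiliary wires and the ancillas have the classical values
given by `α` and `β`, the other auxiliary wires are perfectly correlated. -/
def Match (L k : ℕ) (α β a b : Qubits (numWires nI nK T)) : Prop :=
  (∀ i : Fin nK, (i : ℕ) < k → a (auxW i) = α (auxW i) ∧ b (auxW i) = β (auxW i)) ∧
  (∀ y, a (wire (.inr y)) = α (wire (.inr y)) ∧ b (wire (.inr y)) = β (wire (.inr y))) ∧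
  (∀ i : Fin nK, k ≤ (i : ℕ) → a (auxW i) = b (auxW i)) ∧
  ∃ l < L, ∀ i : Fin nK, T ≤ (i : ℕ) → a (auxW i) = l.testBit (i - T)

/-- Amplitudes of the input wires; the last argument numbers the members of a mixture. -/
abbrev Amp (nI : ℕ) (X : Type*) : Type _ := (Fin nI → Bool) → (Fin nI → Bool) → X → ℂ

open Classical in
/-- The joint state after `k` checks. -/
noncomputable def stage {X : Type*} (L k : ℕ) (α β : Qubits (numWires nI nK T)) (χ : Amp nI X) :
    Matrix (Qubits (numWires nI nK T) × Qubits (numWires nI nK T)) X ℂ :=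
  fun p x => if Match L k α β p.1 p.2 then χ (fun j => p.1 (inW j)) (fun j => p.2 (inW j)) x else 0

/-- The operator `Z^v X^u ⊗ Z^v X^u`. -/
def pauli {X : Type*} (u v : Fin nI → Bool) (χ : Amp nI X) : Amp nI X := fun p q x =>
  sgn (parity fun j => v j && p j) * sgn (parity fun j => v j && q j) *
    χ (fun j => xor (p j) (u j)) (fun j => xor (q j) (u j)) x

/-- The amplitudes after a check with outcome `s`. -/
noncomputable def checked {X : Type*} (u v : Fin nI → Bool) (s : Bool) (χ : Amp nI X) :
    Amp nI X := fun p q x =>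
  (1 / 2 * (1 / 2) ^ nI : ℂ) * (χ p q x + sgn s * pauli u v χ p q x)

/-- The ancillas of the checks from number `k` on are zero. -/
def Fresh (k : ℕ) (α : Qubits (numWires nI nK T)) : Prop :=
  ∀ k' : Fin T, k ≤ (k' : ℕ) →
    (∀ j, α (uW k' j) = false) ∧ (∀ j, α (vW k' j) = false) ∧ α (synW k'.succ) = false

/-- The classical values after a check. -/
noncomputable def record (hT : T ≤ nK) (k : Fin T) (u v : Fin nI → Bool) (s : Bool)
    (α : Qubits (numWires nI nK T)) : Qubits (numWires nI nK T) :=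
  Function.update (shift (vW k) v (shift (uW k) u α)) (auxW (k.castLE hT)) s

noncomputable def recordAlice (hT : T ≤ nK) (k : Fin T) (u v : Fin nI → Bool) (s : Bool)
    (α : Qubits (numWires nI nK T)) : Qubits (numWires nI nK T) :=
  Function.update (record hT k u v s α) (synW k.succ) (α (synW k.castSucc) || s)

lemma uW_injective (k : Fin T) :
    Function.Injective (uW k : Fin nI → Fin (numWires nI nK T)) := by
  intro j j' h; simpa using h

lemma vW_injective (k : Fin T) :
    Function.Injective (vW k : Fin nI → Fin (numWires nI nK T)) := by
  intro j j' h; simpa using h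

lemma inW_injective : Function.Injective (inW : Fin nI → Fin (numWires nI nK T)) := by
  intro j j' h; simpa using h

lemma shift_eq_iff {w m : ℕ} (ws : Fin m → Fin w) (r : Fin m → Bool) (a α : Qubits w)
    (i : Fin w) : shift ws r a i = α i ↔ a i = shift ws r α i := by
  simp only [shift]
  cases a i <;> cases α i <;> cases decide (∃ j, ws j = i ∧ r j = true) <;> simp

/-- The label whose amplitude the `k`-th check moves to `a`. -/
noncomputable def pullback (hT : T ≤ nK) (k : Fin T) (u v : Fin nI → Bool) (c : Bool)
    (a : Qubits (numWires nI nK T)) : Qubits (numWires nI nK T) :=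
  shift (uW k) u (shift (vW k) v (shift inW (fun j => a (uW k j) && c)
    (Function.update a (auxW (k.castLE hT)) c)))

lemma pullback_aux_of_ne (hT : T ≤ nK) (k : Fin T) (u v : Fin nI → Bool) (c : Bool)
    (a : Qubits (numWires nI nK T)) (i : Fin nK) (hi : (i : ℕ) ≠ k) :
    pullback hT k u v c a (auxW i) = a (auxW i) := by
  have : i ≠ k.castLE hT := fun h => hi (by rw [h]; rfl)
  simp [pullback, shift, this]

lemma pullback_aux_self (hT : T ≤ nK) (k : Fin T) (u v : Fin nI → Bool) (c : Bool)
    (a : Qubits (numWires nI nK T)) :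
    pullback hT k u v c a (auxW (k.castLE hT)) = c := by
  simp [pullback, shift]

lemma pullback_ancilla (hT : T ≤ nK) (k : Fin T) (u v : Fin nI → Bool) (c : Bool)
    (a α : Qubits (numWires nI nK T)) (y) :
    pullback hT k u v c a (wire (.inr y)) = α (wire (.inr y)) ↔
      a (wire (.inr y)) = shift (vW k) v (shift (uW k) u α) (wire (.inr y)) := by
  rw [pullback, shift_eq_iff, shift_eq_iff, shift_apply_not_mem _ _ (by simp),
    Function.update_of_ne (by simp)]

lemma pullback_in (hT : T ≤ nK) (k : Fin T) (u v : Fin nI → Bool) (c : Bool)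
    (a : Qubits (numWires nI nK T)) (j : Fin nI) :
    pullback hT k u v c a (inW j) = xor (a (inW j)) (a (uW k j) && c) := by
  rw [pullback, shift_apply_not_mem _ _ (by simp), shift_apply_not_mem _ _ (by simp),
    shift_apply_mem inW_injective, Function.update_of_ne (by simp)]

lemma record_ancilla (hT : T ≤ nK) (k : Fin T) (u v : Fin nI → Bool) (s : Bool)
    (α : Qubits (numWires nI nK T)) (y) :
    record hT k u v s α (wire (.inr y)) =
      shift (vW k) v (shift (uW k) u α) (wire (.inr y)) := by
  rw [record, Function.update_of_ne (by simp)]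

lemma record_aux_of_ne (hT : T ≤ nK) (k : Fin T) (u v : Fin nI → Bool) (s : Bool)
    (α : Qubits (numWires nI nK T)) (i : Fin nK) (hi : (i : ℕ) ≠ k) :
    record hT k u v s α (auxW i) = α (auxW i) := by
  have : i ≠ k.castLE hT := fun h => hi (by rw [h]; rfl)
  simp [record, shift, this]

lemma record_aux_self (hT : T ≤ nK) (k : Fin T) (u v : Fin nI → Bool) (s : Bool)
    (α : Qubits (numWires nI nK T)) :
    record hT k u v s α (auxW (k.castLE hT)) = s := by
  simp [record]

lemma shift_syn (k : Fin T) (k' : Fin (T + 1)) (u v : Fin nI → Bool)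
    (α : Qubits (numWires nI nK T)) :
    shift (vW k) v (shift (uW k) u α) (synW k') = α (synW k') := by
  rw [shift_apply_not_mem _ _ (by simp), shift_apply_not_mem _ _ (by simp)]

/-- Alice's accumulation of the syndromes. -/
noncomputable def accumulate (hT : T ≤ nK) (k : Fin T) (a : Qubits (numWires nI nK T)) :
    Qubits (numWires nI nK T) :=
  xorAt (synW k.succ) (a (synW k.castSucc) || a (auxW (k.castLE hT))) a

/-- The next syndrome wire starts at zero by `Fresh`, so adding the disjunction to it stores exactly
the updated failure flag; all other ancillas are untouched. -/
lemma accumulate_ancilla (hT : T ≤ nK) (k : Fin T) (u v : Fin nI → Bool) {s : Bool}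
    {a α : Qubits (numWires nI nK T)} (hα : Fresh k α) (hs : a (auxW (k.castLE hT)) = s) :
    (∀ y, accumulate hT k a (wire (.inr y)) =
        shift (vW k) v (shift (uW k) u α) (wire (.inr y))) ↔
      ∀ y, a (wire (.inr y)) = recordAlice hT k u v s α (wire (.inr y)) := by
  have hne : (synW k.castSucc : Fin (numWires nI nK T)) ≠ synW k.succ := by
    simp [Fin.ext_iff]
  have h0 : α (synW k.succ) = false := (hα k le_rfl).2.2
  have other : ∀ y, (wire (.inr y) : Fin (numWires nI nK T)) ≠ synW k.succ →
      (accumulate hT k a (wire (.inr y)) = shift (vW k) v (shift (uW k) u α) (wire (.inr y)) ↔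
        a (wire (.inr y)) = recordAlice hT k u v s α (wire (.inr y))) := by
    intro y hy
    rw [accumulate, xorAt_of_ne hy, recordAlice, Function.update_of_ne hy, record_ancilla]
  have self : a (synW k.castSucc) = α (synW k.castSucc) →
      (accumulate hT k a (synW k.succ) = shift (vW k) v (shift (uW k) u α) (synW k.succ) ↔
        a (synW k.succ) = recordAlice hT k u v s α (synW k.succ)) := by
    intro h
    rw [accumulate, xorAt_self, shift_syn, h0, h, hs, recordAlice, Function.update_self]
    cases a (synW k.succ) <;> cases (α (synW k.castSucc) || s) <;> simp
  constructor
  · intro h y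
    by_cases hy : (wire (.inr y) : Fin (numWires nI nK T)) = synW k.succ
    · rw [hy]
      refine (self ?_).1 (by rw [← hy]; exact h y)
      have := (other _ hne).1 (h _)
      rwa [recordAlice, Function.update_of_ne hne, record_ancilla, shift_syn] at this
    · exact (other y hy).1 (h y)
  · intro h y
    by_cases hy : (wire (.inr y) : Fin (numWires nI nK T)) = synW k.succ
    · rw [hy]
      refine (self ?_).2 (by rw [← hy]; exact h y)
      have := h (.inr k.castSucc)
      rwa [recordAlice, Function.update_of_ne hne, record_ancilla, shift_syn] at this
    · exact (other y hy).2 (h y)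

lemma recordAlice_aux (hT : T ≤ nK) (k : Fin T) (u v : Fin nI → Bool) (s : Bool)
    (α : Qubits (numWires nI nK T)) (i : Fin nK) :
    recordAlice hT k u v s α (auxW i) = record hT k u v s α (auxW i) := by
  rw [recordAlice, Function.update_of_ne (by simp)]

lemma accumulate_of_ne (hT : T ≤ nK) (k : Fin T) (a : Qubits (numWires nI nK T))
    {i : Fin (numWires nI nK T)} (hi : i ≠ synW k.succ) : accumulate hT k a i = a i := by
  rw [accumulate, xorAt_of_ne hi]

/-- The right side does not involve `c`. Before the check, `Match` asks of the consumed pair only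
that both bits agree, and both pullbacks put `c` there; after it, the pair holds the recorded bits
`s` and `y`. -/
lemma match_pullback (hT : T ≤ nK) (L : ℕ) (k : Fin T) (u v : Fin nI → Bool) {s y : Bool}
    {a b α β : Qubits (numWires nI nK T)} (hα : Fresh k α)
    (hs : a (auxW (k.castLE hT)) = s) (hy : b (auxW (k.castLE hT)) = y) (c : Bool) :
    Match L k α β (pullback hT k u v c (accumulate hT k a)) (pullback hT k u v c b) ↔
      Match L (k + 1) (recordAlice hT k u v s α) (record hT k u v y β) a b := by
  have hacc : ∀ i : Fin nK, accumulate hT k a (auxW i) = a (auxW i) := fun i =>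
    accumulate_of_ne hT k a (by simp)
  refine and_congr ?_ (and_congr ?_ (and_congr ?_ ?_))
  · constructor
    · intro h i hi
      rw [recordAlice_aux]
      by_cases hik : (i : ℕ) = k
      · have : i = k.castLE hT := Fin.ext hik
        rw [this, record_aux_self, record_aux_self]
        exact ⟨hs, hy⟩
      · have := h i (by omega)
        rwa [pullback_aux_of_ne _ _ _ _ _ _ _ hik, pullback_aux_of_ne _ _ _ _ _ _ _ hik, hacc,
          ← record_aux_of_ne hT k u v s α i hik, ← record_aux_of_ne hT k u v y β i hik] at this
    · intro h i hi
      have hik : (i : ℕ) ≠ k := by omega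
      have := h i (by omega)
      rw [pullback_aux_of_ne _ _ _ _ _ _ _ hik, pullback_aux_of_ne _ _ _ _ _ _ _ hik, hacc]
      rwa [recordAlice_aux, record_aux_of_ne _ _ _ _ _ _ _ hik,
        record_aux_of_ne _ _ _ _ _ _ _ hik] at this
  · simp only [pullback_ancilla]
    rw [forall_and, forall_and, accumulate_ancilla hT k u v hα hs]
    simp only [record_ancilla]
  · constructor
    · intro h i hi
      have hik : (i : ℕ) ≠ k := by omega
      have := h i (by omega)
      rwa [pullback_aux_of_ne _ _ _ _ _ _ _ hik, pullback_aux_of_ne _ _ _ _ _ _ _ hik, hacc]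
        at this
    · intro h i hi
      by_cases hik : (i : ℕ) = k
      · have : i = k.castLE hT := Fin.ext hik
        rw [this, pullback_aux_self, pullback_aux_self]
      · rw [pullback_aux_of_ne _ _ _ _ _ _ _ hik, pullback_aux_of_ne _ _ _ _ _ _ _ hik, hacc]
        exact h i (by omega)
  · refine exists_congr fun l => and_congr_right fun _ => forall_congr' fun i =>
      imp_congr_right fun hi => ?_
    rw [pullback_aux_of_ne _ _ _ _ _ _ _ (by omega), hacc]

variable {X : Type*}

lemma shift_false_uW {k : Fin T} {α : Qubits (numWires nI nK T)} (hα : Fresh k α)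
    (u v : Fin nI → Bool) (j : Fin nI) :
    shift (vW k) v (shift (uW k) u α) (uW k j) = u j := by
  rw [shift_apply_not_mem _ _ (by simp), shift_apply_mem (uW_injective k), (hα k le_rfl).1 j]
  simp

lemma shift_false_vW {k : Fin T} {α : Qubits (numWires nI nK T)} (hα : Fresh k α)
    (u v : Fin nI → Bool) (j : Fin nI) :
    shift (vW k) v (shift (uW k) u α) (vW k j) = v j := by
  rw [shift_apply_mem (vW_injective k), shift_apply_not_mem _ _ (by simp), (hα k le_rfl).2.1 j]
  simp

lemma recordAlice_of_ne (hT : T ≤ nK) (k : Fin T) (u v : Fin nI → Bool) (s : Bool)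
    (α : Qubits (numWires nI nK T)) {i : Fin (numWires nI nK T)} (hi : i ≠ synW k.succ) :
    recordAlice hT k u v s α i = record hT k u v s α i := by
  rw [recordAlice, Function.update_of_ne hi]

/-- The amplitude factors of sampling `u` and `v` combined. -/
lemma half_pow : (((1 / Real.sqrt 2 : ℝ) : ℂ) ^ nI) * ((1 / Real.sqrt 2 : ℝ) : ℂ) ^ nI =
    (1 / 2) ^ nI := by
  rw [← mul_pow, ← Complex.ofReal_mul]
  congr 1
  have : (1 / Real.sqrt 2) * (1 / Real.sqrt 2) = 1 / 2 := by
    rw [div_mul_div_comm, Real.mul_self_sqrt (by norm_num), one_mul]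
  rw [this]; norm_num

open Classical in
-- The consumed pair is perfectly correlated, so terms with `c ≠ c'` vanish: either both parties
-- apply the controlled `X^u` or neither does.
lemma stage_pullback (hT : T ≤ nK) (L : ℕ) (k : Fin T) (u v : Fin nI → Bool) {s y : Bool}
    {a b α β : Qubits (numWires nI nK T)} (hα : Fresh k α) (hβ : Fresh k β)
    (hs : a (auxW (k.castLE hT)) = s) (hy : b (auxW (k.castLE hT)) = y) (c c' : Bool)
    (χ : Amp nI X) (x : X) :
    stage L k α β χ (pullback hT k u v c (accumulate hT k a), pullback hT k u v c' b) x =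
      if c = c' ∧ Match L (k + 1) (recordAlice hT k u v s α) (record hT k u v y β) a b then
        χ (fun j => xor (a (inW j)) (u j && c)) (fun j => xor (b (inW j)) (u j && c)) x
      else 0 := by
  by_cases hc : c = c'
  · subst hc
    simp only [stage, match_pullback hT L k u v hα hs hy, true_and]
    refine if_ctx_congr Iff.rfl (fun hM => ?_) fun _ => rfl
    have hu : ∀ j, a (uW k j) = u j := fun j => by
      rw [(hM.2.1 _).1, recordAlice_of_ne _ _ _ _ _ _ (by simp), record_ancilla,
        shift_false_uW hα]
    have hu' : ∀ j, b (uW k j) = u j := fun j => by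
      rw [(hM.2.1 _).2, record_ancilla, shift_false_uW hβ]
    have hacc : ∀ j, accumulate hT k a (uW k j) = u j := fun j => by
      rw [accumulate_of_ne hT k a (by simp), hu]
    have hacc' : ∀ j, accumulate hT k a (inW j) = a (inW j) := fun j =>
      accumulate_of_ne hT k a (by simp)
    simp only [pullback_in, hu', hacc, hacc']
  · rw [stage, if_neg, if_neg (fun h => hc h.1)]
    intro hM
    have := hM.2.2.1 (k.castLE hT) le_rfl
    dsimp only at this
    rw [pullback_aux_self, pullback_aux_self] at this
    exact hc this

end Checks

/-! ### One check acts as the projection `(1 ± P) / 2` -/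

section CheckStep

variable {nI nK T : ℕ} {X : Type*}

/-- The effect of the syndrome measurement on a joint state: before it the parties have applied
the controlled gates that end up in `pullback`. -/
lemma syndrome_amplitude (hT : T ≤ nK) (L : ℕ) (k : Fin T) (u v : Fin nI → Bool) (s y : Bool)
    {a b α β : Qubits (numWires nI nK T)} (hα : Fresh k α) (hβ : Fresh k β)
    (hs : a (auxW (k.castLE hT)) = s) (hy : b (auxW (k.castLE hT)) = y)
    (χ : Amp nI X) (x : X) (A B : Bool)
    (hA : A = xor (xor s y) (parity fun j => a (vW k j) && a (inW j)))
    (hB : B = xor y (parity fun j => b (vW k j) && b (inW j))) :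
    ((1 / Real.sqrt 2 : ℝ) : ℂ) * ∑ c', sgn (B && c') *
      (((1 / Real.sqrt 2 : ℝ) : ℂ) * ∑ c, sgn (A && c) *
        (((1 / Real.sqrt 2 : ℝ) : ℂ) ^ nI * (((1 / Real.sqrt 2 : ℝ) : ℂ) ^ nI *
          stage L k α β χ
            (pullback hT k u v c (accumulate hT k a), pullback hT k u v c' b) x))) =
    stage L (k + 1) (recordAlice hT k u v s α) (record hT k u v y β) (checked u v s χ)
      (a, b) x := by
  simp only [stage_pullback hT L k u v hα hβ hs hy, Fintype.sum_bool, ← mul_assoc, half_pow]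
  by_cases hM : Match L (k + 1) (recordAlice hT k u v s α) (record hT k u v y β) a b
  · have hv : ∀ j, a (vW k j) = v j := fun j => by
      rw [(hM.2.1 _).1, recordAlice_of_ne _ _ _ _ _ _ (by simp), record_ancilla,
        shift_false_vW hα]
    have hv' : ∀ j, b (vW k j) = v j := fun j => by
      rw [(hM.2.1 _).2, record_ancilla, shift_false_vW hβ]
    have h2 : ((1 / Real.sqrt 2 : ℝ) : ℂ) * ((1 / Real.sqrt 2 : ℝ) : ℂ) = 1 / 2 := by
      simpa using half_pow (nI := 1)
    -- Bob's raw outcome `y` occurs in both signs and cancels; what remains is the syndrome `s` and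
    -- the action of `Z^v` on both sides.
    have hAB : sgn A * sgn B = sgn s * (sgn (parity fun j => v j && a (inW j)) *
        sgn (parity fun j => v j && b (inW j))) := by
      rw [hA, hB]
      simp only [hv, hv', sgn_xor]
      have : sgn y * sgn y = 1 := by cases y <;> simp [sgn]
      linear_combination (sgn s * (sgn (parity fun j => v j && a (inW j)) *
        sgn (parity fun j => v j && b (inW j)))) * this
    have hf : sgn false = 1 := rfl
    simp only [hM, and_true, stage, if_true, checked, pauli, Bool.and_true, Bool.and_false,
      Bool.xor_false, hf, reduceCtorEq, if_false, mul_zero, add_zero, zero_add, one_mul]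
    linear_combination
      ((1 / 2) ^ nI * χ (fun j => a (inW j)) (fun j => b (inW j)) x +
        sgn A * sgn B * (1 / 2) ^ nI *
          χ (fun j => xor (a (inW j)) (u j)) (fun j => xor (b (inW j)) (u j)) x) * h2 +
      (1 / 2 * (1 / 2) ^ nI *
        χ (fun j => xor (a (inW j)) (u j)) (fun j => xor (b (inW j)) (u j)) x) * hAB
  · simp [hM, stage]

lemma stage_eq_zero {L k : ℕ} {α β a b : Qubits (numWires nI nK T)} {χ : Amp nI X} {x : X}
    (h : ¬ Match L k α β a b) : stage L k α β χ (a, b) x = 0 := if_neg h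

/-- The two CNOTs and the Toffoli gate compute a disjunction, since `x ⊕ y ⊕ xy = x ∨ y`. -/
lemma perm_accumulate (hT : T ≤ nK) (k : Fin T) (a : Qubits (numWires nI nK T)) :
    xorAt (synW k.succ) (xorAt (synW k.succ)
      (xorAt (synW k.succ) (a (synW k.castSucc) && a (auxW (k.castLE hT))) a
        (auxW (k.castLE hT))) (xorAt (synW k.succ)
          (a (synW k.castSucc) && a (auxW (k.castLE hT))) a) (synW k.castSucc))
      (xorAt (synW k.succ)
      (xorAt (synW k.succ) (a (synW k.castSucc) && a (auxW (k.castLE hT))) a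
        (auxW (k.castLE hT))) (xorAt (synW k.succ)
          (a (synW k.castSucc) && a (auxW (k.castLE hT))) a)) = accumulate hT k a := by
  have h1 : (synW k.castSucc : Fin (numWires nI nK T)) ≠ synW k.succ := by
    simp [Fin.ext_iff]
  have h2 : (auxW (k.castLE hT) : Fin (numWires nI nK T)) ≠ synW k.succ := by simp
  simp only [xorAt_of_ne h1, xorAt_of_ne h2, xorAt_xorAt, accumulate]
  congr 1
  cases a (synW k.castSucc) <;> cases a (auxW (k.castLE hT)) <;> rfl

variable [Fintype X] {β : Type*} [AddCommMonoid β]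

/-- The bit `y` is Bob's outcome. Alice's bit `s` is measured after Bob's bit was added to her wire,
hence is the sum of the two raw outcomes. Only `s` affects the input amplitudes. -/
lemma total_check (hT : T ≤ nK) (L : ℕ) (k : Fin T) {α α' : Qubits (numWires nI nK T)}
    (hα : Fresh k α) (hα' : Fresh k α') (χ : Amp nI X) (l : List (Step (numWires nI nK T)))
    (Φ : JointOp (numWires nI nK T) → β) :
    total (check hT k ++ l) (stage L k α α' χ) Φ =
      ∑ u, ∑ v, ∑ y, ∑ s, total l (stage L (k + 1) (recordAlice hT k u v s α)
        (record hT k u v y α') (checked u v s χ)) Φ := by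
  simp only [check, List.append_assoc, List.cons_append, List.nil_append]
  rw [total_sample (uW_injective k)]
  swap
  · intro a b x j h
    refine stage_eq_zero fun hM => ?_
    have := (hM.2.1 (.inl (.inl (k, j)))).1
    rw [h, (hα k le_rfl).1 j] at this
    exact absurd this (by simp)
  refine Finset.sum_congr rfl fun u _ => ?_
  rw [total_sample (vW_injective k)]
  swap
  · intro a b x j h
    rw [Matrix.of_apply, stage_eq_zero, mul_zero]
    intro hM
    have := (hM.2.1 (.inl (.inr (k, j)))).1
    dsimp only at this
    rw [shift_apply_not_mem _ _ (by simp), h, (hα k le_rfl).2.1 j] at this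
    exact absurd this (by simp)
  refine Finset.sum_congr rfl fun v _ => ?_
  rw [total_both, total_had_alice, total_had_bob, total_both, total_send_bob]
  rotate_left
  · exact fun _ => trivial
  · exact fun _ => trivial
  refine Finset.sum_congr rfl fun y _ => ?_
  rw [total_measure_alice]
  refine Finset.sum_congr rfl fun s _ => ?_
  rw [total_classical_alice, total_classical_alice, total_classical_alice]
  rotate_left
  · exact trivial
  · exact trivial
  · exact trivial
  congr 1
  ext ⟨a, b⟩ x
  simp only [Matrix.of_apply, Gate.perm]
  rw [perm_accumulate hT k a]
  have hacc : accumulate hT k a (auxW (k.castLE hT)) = a (auxW (k.castLE hT)) :=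
    accumulate_of_ne hT k a (by simp)
  rw [hacc]
  by_cases hs : a (auxW (k.castLE hT)) = s
  swap
  · rw [if_neg hs, stage_eq_zero]
    intro hM
    have := (hM.1 (k.castLE hT) (by simp)).1
    rw [recordAlice_aux, record_aux_self] at this
    exact hs this
  by_cases hy : b (auxW (k.castLE hT)) = y
  swap
  · rw [if_pos hs, if_neg hy, stage_eq_zero]
    intro hM
    have := (hM.1 (k.castLE hT) (by simp)).2
    rw [record_aux_self] at this
    exact hy this
  rw [if_pos hs, if_pos hy]
  have hu : ∀ j j', (uW k j : Fin (numWires nI nK T)) ≠ inW j' := by simp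
  have hv : ∀ j, (vW k j : Fin (numWires nI nK T)) ≠ auxW (k.castLE hT) := by simp
  have he : ∀ j, (auxW (k.castLE hT) : Fin (numWires nI nK T)) ≠ inW j := by simp
  have hc := fun a : Qubits (numWires nI nK T) =>
    foldr_toffoli_controls (inp := inW) (v := vW k) _ hv (fun j => (he j).symm) a
  have ht := fun a : Qubits (numWires nI nK T) =>
    foldr_toffoli_targets (u := uW k) (auxW (k.castLE hT)) inW_injective hu he a
  simp only [hc, ht]
  rw [← syndrome_amplitude hT L k u v s y hα hα' hs hy χ x _ _ rfl rfl]
  have hpull : ∀ (a' : Qubits (numWires nI nK T)) (d c : Bool),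
      shift (uW k) u (shift (vW k) v (shift inW
        (fun j => Function.update (xorAt (auxW (k.castLE hT)) d a') (auxW (k.castLE hT)) c (uW k j)
          && Function.update (xorAt (auxW (k.castLE hT)) d a') (auxW (k.castLE hT)) c
            (auxW (k.castLE hT)))
        (Function.update (xorAt (auxW (k.castLE hT)) d a') (auxW (k.castLE hT)) c))) =
      pullback hT k u v c a' := by
    intro a' d c
    have h1 : ∀ j, (uW k j : Fin (numWires nI nK T)) ≠ auxW (k.castLE hT) := by simp
    have h2 : Function.update (xorAt (auxW (k.castLE hT)) d a') (auxW (k.castLE hT)) c =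
        Function.update a' (auxW (k.castLE hT)) c := by simp [xorAt]
    simp only [h2, Function.update_self, Function.update_of_ne (h1 _), xorAt_of_ne (h1 _), pullback]
  have hin : ∀ j, accumulate hT k a (inW j) = a (inW j) := fun j =>
    accumulate_of_ne hT k a (by simp)
  have hvW : ∀ j, accumulate hT k a (vW k j) = a (vW k j) := fun j =>
    accumulate_of_ne hT k a (by simp)
  simp only [xorAt_xorAt, hpull, xorAt_self, xorAt_of_ne (hv _), xorAt_of_ne (he _).symm, hin, hvW,
    hacc, hs, hy, Bool.xor_assoc]

end CheckStep

/-! ### Averaging over random checks -/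

section Expansion

variable {nI : ℕ} {X : Type*} {β : Type*}

/-- The sum of `φ` over the outcomes of `j` further checks. -/
noncomputable def expand [AddCommMonoid β] (φ : Bool → Amp nI X → β) :
    ℕ → Bool → Amp nI X → β
  | 0, h, χ => φ h χ
  | j + 1, h, χ => ∑ u, ∑ v, ∑ _y : Bool, ∑ s, expand φ j (h || s) (checked u v s χ)

lemma expand_zero_fun [AddCommMonoid β] (j : ℕ) (h : Bool) (χ : Amp nI X) :
    expand (fun _ _ => (0 : β)) j h χ = 0 := by
  induction j generalizing h χ with
  | zero => rfl
  | succ j ih => simp [expand, ih]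

lemma expand_sub (φ φ' : Bool → Amp nI X → ℝ) (j : ℕ) (h : Bool) (χ : Amp nI X) :
    expand (fun h χ => φ h χ - φ' h χ) j h χ = expand φ j h χ - expand φ' j h χ := by
  induction j generalizing h χ with
  | zero => rfl
  | succ j ih => simp only [expand, ih, Finset.sum_sub_distrib]

lemma expand_const_mul (c : ℝ) (φ : Bool → Amp nI X → ℝ) (j : ℕ) (h : Bool) (χ : Amp nI X) :
    expand (fun h χ => c * φ h χ) j h χ = c * expand φ j h χ := by
  induction j generalizing h χ with
  | zero => rfl
  | succ j ih => simp only [expand, ih, Finset.mul_sum]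

lemma expand_mono {φ φ' : Bool → Amp nI X → ℝ} (hφ : ∀ h χ, φ h χ ≤ φ' h χ) (j : ℕ) (h : Bool)
    (χ : Amp nI X) : expand φ j h χ ≤ expand φ' j h χ := by
  induction j generalizing h χ with
  | zero => exact hφ h χ
  | succ j ih =>
    exact Finset.sum_le_sum fun u _ => Finset.sum_le_sum fun v _ => Finset.sum_le_sum fun y _ =>
      Finset.sum_le_sum fun s _ => ih _ _

lemma expand_nonneg {φ : Bool → Amp nI X → ℝ} (hφ : ∀ h χ, 0 ≤ φ h χ) (j : ℕ) (h : Bool)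
    (χ : Amp nI X) : 0 ≤ expand φ j h χ := by
  rw [← expand_zero_fun (β := ℝ) j h χ]
  exact expand_mono hφ j h χ

/-- This replaces Markov's inequality when the threshold is zero. -/
lemma expand_eq_zero {φ φ' : Bool → Amp nI X → ℝ} (hφ : ∀ h χ, 0 ≤ φ h χ)
    (h0 : ∀ h χ, φ h χ = 0 → φ' h χ = 0) (j : ℕ) (h : Bool) (χ : Amp nI X)
    (hz : expand φ j h χ = 0) : expand φ' j h χ = 0 := by
  induction j generalizing h χ with
  | zero => exact h0 h χ hz
  | succ j ih =>
    have hs := fun u v s => expand_nonneg hφ j (h || s) (checked u v s χ)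
    refine Finset.sum_eq_zero fun u _ => Finset.sum_eq_zero fun v _ => Finset.sum_eq_zero
      fun y _ => Finset.sum_eq_zero fun s _ => ih _ _ ?_
    have h1 := (Finset.sum_eq_zero_iff_of_nonneg fun u _ => Finset.sum_nonneg fun v _ =>
      Finset.sum_nonneg fun _ _ => Finset.sum_nonneg fun s _ => hs u v s).1 hz u
      (Finset.mem_univ _)
    have h2 := (Finset.sum_eq_zero_iff_of_nonneg fun v _ =>
      Finset.sum_nonneg fun _ _ => Finset.sum_nonneg fun s _ => hs u v s).1 h1 v
      (Finset.mem_univ _)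
    have h3 := (Finset.sum_eq_zero_iff_of_nonneg fun _ _ =>
      Finset.sum_nonneg fun s _ => hs u v s).1 h2 y (Finset.mem_univ _)
    exact (Finset.sum_eq_zero_iff_of_nonneg fun s _ => hs u v s).1 h3 s (Finset.mem_univ _)

lemma expand_passed_true (f : Amp nI X → ℝ) (j : ℕ) (χ : Amp nI X) :
    expand (fun h χ => if h then 0 else f χ) j true χ = 0 := by
  induction j generalizing χ with
  | zero => rfl
  | succ j ih => simp [expand, ih]

/-- The failure flag never resets, so only `s = false` contributes. The factor `2` counts the values
of `y`, on which nothing depends. -/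
lemma expand_passed_succ (f : Amp nI X → ℝ) (j : ℕ) (χ : Amp nI X) :
    expand (fun h χ => if h then 0 else f χ) (j + 1) false χ =
      ∑ u, ∑ v, 2 * expand (fun h χ => if h then 0 else f χ) j false (checked u v false χ) := by
  simp only [expand, Fintype.sum_bool, Bool.or_true, Bool.or_false, expand_passed_true, zero_add]
  refine Finset.sum_congr rfl fun u _ => Finset.sum_congr rfl fun v _ => (two_mul _).symm

lemma sgn_mul_self (c : Bool) : sgn c * sgn c = 1 := by cases c <;> simp [sgn]

/-- Addition of bit strings. -/
def xorEquiv (u : Fin nI → Bool) : (Fin nI → Bool) ≃ (Fin nI → Bool) :=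
  Function.Involutive.toPerm (fun p j => xor (p j) (u j)) fun p => by ext j; simp

/-- On the diagonal the two signs cancel and `X^u` only permutes the entries. This is the invariance
of the maximally entangled vector under `P`. -/
lemma sum_diag_pauli (u v : Fin nI → Bool) (χ : Amp nI X) (x : X) :
    ∑ p, pauli u v χ p p x = ∑ p, χ p p x := by
  simp only [pauli, sgn_mul_self, one_mul]
  exact Equiv.sum_comp (xorEquiv u) fun p => χ p p x

variable [Fintype X]

/-- The squared norm. -/
noncomputable def normSqAmp (χ : Amp nI X) : ℝ := ∑ p, ∑ q, ∑ x, Complex.normSq (χ p q x)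

/-- The squared overlap with the unnormalized maximally entangled vector `∑ p, |p⟩|p⟩`. -/
noncomputable def overlap (χ : Amp nI X) : ℝ := ∑ x, Complex.normSq (∑ p, χ p p x)

/-- The inner product. -/
noncomputable def innerAmp (χ χ' : Amp nI X) : ℂ :=
  ∑ p, ∑ q, ∑ x, χ p q x * (starRingEnd ℂ) (χ' p q x)

lemma normSq_sum_le {ι : Type*} (s : Finset ι) (f : ι → ℂ) :
    Complex.normSq (∑ i ∈ s, f i) ≤ s.card * ∑ i ∈ s, Complex.normSq (f i) := by
  simp only [Complex.normSq_eq_norm_sq]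
  calc ‖∑ i ∈ s, f i‖ ^ 2 ≤ (∑ i ∈ s, ‖f i‖) ^ 2 := by gcongr; exact norm_sum_le _ _
    _ ≤ _ := sq_sum_le_card_mul_sum_sq

lemma normSqAmp_nonneg (χ : Amp nI X) : 0 ≤ normSqAmp χ :=
  Finset.sum_nonneg fun _ _ => Finset.sum_nonneg fun _ _ => Finset.sum_nonneg fun _ _ =>
    Complex.normSq_nonneg _

lemma overlap_le (χ : Amp nI X) : overlap χ ≤ 2 ^ nI * normSqAmp χ := by
  calc overlap χ ≤ ∑ x, 2 ^ nI * ∑ p, Complex.normSq (χ p p x) := by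
        refine Finset.sum_le_sum fun x _ => ?_
        simpa using normSq_sum_le Finset.univ fun p => χ p p x
    _ = 2 ^ nI * ∑ p, ∑ x, Complex.normSq (χ p p x) := by
        rw [← Finset.mul_sum, Finset.sum_comm]
    _ ≤ _ := by
        unfold normSqAmp
        gcongr with p
        exact Finset.single_le_sum (f := fun q => ∑ x, Complex.normSq (χ p q x))
          (fun q _ => Finset.sum_nonneg fun x _ => Complex.normSq_nonneg _) (Finset.mem_univ p)

lemma normSq_sgn (c : Bool) : Complex.normSq (sgn c) = 1 := by cases c <;> simp [sgn]

lemma normSqAmp_pauli (u v : Fin nI → Bool) (χ : Amp nI X) :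
    normSqAmp (pauli u v χ) = normSqAmp χ := by
  simp only [normSqAmp, pauli, Complex.normSq_mul, normSq_sgn, one_mul]
  change ∑ p, ∑ q, ∑ x, Complex.normSq (χ (xorEquiv u p) (xorEquiv u q) x) = _
  rw [Equiv.sum_comp (xorEquiv u) fun p => ∑ q, ∑ x, Complex.normSq (χ p (xorEquiv u q) x)]
  refine Finset.sum_congr rfl fun p _ => ?_
  exact Equiv.sum_comp (xorEquiv u) fun q => ∑ x, Complex.normSq (χ p q x)

/-- Orthogonality of the characters of `F_2^n`, as a product over the coordinates. -/
lemma sum_signs (p q : Fin nI → Bool) :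
    ∑ v : Fin nI → Bool, sgn (parity fun j => v j && p j) * sgn (parity fun j => v j && q j) =
      if p = q then 2 ^ nI else 0 := by
  simp only [sgn_parity, ← Finset.prod_mul_distrib]
  have := Finset.prod_univ_sum (fun _ : Fin nI => (Finset.univ : Finset Bool))
    fun j c => sgn (c && p j) * sgn (c && q j)
  rw [Fintype.piFinset_univ] at this
  rw [← this]
  have h : ∀ j, ∑ c, sgn (c && p j) * sgn (c && q j) = if p j = q j then 2 else 0 := by
    intro j
    cases p j <;> cases q j <;> simp [sgn, one_add_one_eq_two]
  simp only [h]
  split_ifs with hpq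
  · subst hpq; simp
  · obtain ⟨j, hj⟩ := Function.ne_iff.1 hpq
    exact Finset.prod_eq_zero (Finset.mem_univ j) (if_neg hj)

/-- The average of `P` over its `4^n` choices is the projector onto the maximally entangled vector:
the sum over `v` leaves the diagonal entries, and the sum over `u` pairs every diagonal entry with
every other one, giving the square of their sum. -/
lemma sum_innerAmp_pauli (χ : Amp nI X) :
    ∑ u, ∑ v, (innerAmp (pauli u v χ) χ).re = 2 ^ nI * overlap χ := by
  have key : ∑ u, ∑ v, innerAmp (pauli u v χ) χ = ((2 ^ nI * overlap χ : ℝ) : ℂ) := by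
    have h1 : ∀ u, ∑ v, innerAmp (pauli u v χ) χ = 2 ^ nI * ∑ x, ∑ p,
        χ (fun j => xor (p j) (u j)) (fun j => xor (p j) (u j)) x *
          (starRingEnd ℂ) (χ p p x) := by
      intro u
      simp only [innerAmp]
      rw [Finset.sum_comm, Finset.sum_comm (s := (Finset.univ : Finset X)), Finset.mul_sum]
      refine Finset.sum_congr rfl fun p _ => ?_
      rw [Finset.sum_comm, Finset.sum_eq_single p, Finset.sum_comm, Finset.mul_sum]
      · refine Finset.sum_congr rfl fun x _ => ?_
        simp only [pauli, mul_assoc]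
        simp only [← mul_assoc, ← Finset.sum_mul, sum_signs, if_true]
      · intro q _ hq
        rw [Finset.sum_comm]
        refine Finset.sum_eq_zero fun x _ => ?_
        simp only [pauli, ← Finset.sum_mul, sum_signs, if_neg hq.symm, zero_mul]
      · simp
    simp only [h1, ← Finset.mul_sum]
    push_cast
    congr 1
    rw [Finset.sum_comm, overlap]
    push_cast
    refine Finset.sum_congr rfl fun x _ => ?_
    rw [Finset.sum_comm, ← Complex.mul_conj, map_sum, Finset.mul_sum]
    refine Finset.sum_congr rfl fun p _ => ?_
    rw [← Finset.sum_mul]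
    congr 1
    rw [← Equiv.sum_comp (xorEquiv p)]
    refine Finset.sum_congr rfl fun u _ => ?_
    have : (fun j => xor (p j) (xorEquiv p u j)) = u := by
      ext j
      change xor (p j) (xor (u j) (p j)) = u j
      cases p j <;> cases u j <;> rfl
    rw [this]
  have := congrArg Complex.re key
  simpa only [Complex.re_sum, Complex.ofReal_re] using this

/-- Expand the square of `χ ± Pχ`; since `P` preserves the norm, only the cross term distinguishes
the two outcomes. -/
lemma normSqAmp_checked (u v : Fin nI → Bool) (s : Bool) (χ : Amp nI X) :
    normSqAmp (checked u v s χ) = 1 / 4 * (1 / 4) ^ nI *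
      (2 * normSqAmp χ + 2 * ((if s then -1 else 1) * (innerAmp (pauli u v χ) χ).re)) := by
  have h4 : Complex.normSq (1 / 2 * (1 / 2) ^ nI) = 1 / 4 * (1 / 4) ^ nI := by
    rw [map_mul, map_pow]
    norm_num
  have hp := normSqAmp_pauli u v χ
  rw [two_mul]
  nth_rewrite 2 [← hp]
  simp only [normSqAmp, checked, innerAmp, Complex.normSq_mul, h4, Complex.re_sum,
    Finset.mul_sum, ← Finset.sum_add_distrib]
  refine Finset.sum_congr rfl fun p _ => Finset.sum_congr rfl fun q _ =>
    Finset.sum_congr rfl fun x _ => ?_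
  congr 1
  cases s
  · simp only [sgn, Complex.normSq_apply, Bool.false_eq_true, if_false, Complex.mul_re,
      Complex.conj_re, Complex.conj_im, Complex.add_re, Complex.add_im, one_mul]
    ring
  · simp only [sgn, Complex.normSq_apply, if_true, Complex.mul_re,
      Complex.conj_re, Complex.conj_im, Complex.add_re, Complex.add_im, neg_mul, one_mul,
      Complex.neg_re, Complex.neg_im]
    ring

lemma sum_const_strings (c : ℝ) :
    ∑ _u : Fin nI → Bool, ∑ _v : Fin nI → Bool, c = 4 ^ nI * c := by
  have : (4 : ℝ) ^ nI = 2 ^ nI * 2 ^ nI := by rw [← mul_pow]; norm_num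
  simp [this, mul_assoc]

lemma quarter_pow : (1 / 4 : ℝ) ^ nI * 4 ^ nI = 1 := by
  rw [← mul_pow]; norm_num

/-- The cross terms of the two outcomes cancel. The factor `2` per check comes from `y`; it makes up
for the consumed pair, which no longer doubles the number of labels in the support. -/
lemma expand_normSqAmp (j : ℕ) (h : Bool) (χ : Amp nI X) :
    expand (fun _ χ => normSqAmp χ) j h χ = 2 ^ j * normSqAmp χ := by
  induction j generalizing h χ with
  | zero => simp [expand]
  | succ j ih =>
    have : ∀ u v, ∑ _y : Bool, ∑ s, 2 ^ j * normSqAmp (checked u v s χ) =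
        2 ^ (j + 1) * (1 / 4) ^ nI * normSqAmp χ := by
      intro u v
      simp only [normSqAmp_checked, Fintype.sum_bool, if_true, Bool.false_eq_true, if_false]
      ring
    simp only [expand, ih, this, sum_const_strings]
    linear_combination 2 ^ (j + 1) * normSqAmp χ * quarter_pow (nI := nI)

lemma overlap_checked (u v : Fin nI → Bool) (χ : Amp nI X) :
    overlap (checked u v false χ) = (1 / 4) ^ nI * overlap χ := by
  have h4 : Complex.normSq ((1 / 2) ^ nI) = (1 / 4) ^ nI := by
    rw [map_pow]; norm_num
  simp only [overlap, Finset.mul_sum]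
  refine Finset.sum_congr rfl fun x _ => ?_
  have : ∑ p, checked u v false χ p p x = (1 / 2) ^ nI * ∑ p, χ p p x := by
    simp only [checked, ← Finset.mul_sum, Finset.sum_add_distrib, sum_diag_pauli, sgn,
      Bool.false_eq_true, if_false, one_mul]
    ring
  rw [this, Complex.normSq_mul, h4]

lemma expand_passed_overlap (j : ℕ) (χ : Amp nI X) :
    expand (fun h χ => if h then 0 else overlap χ) j false χ = 2 ^ j * overlap χ := by
  induction j generalizing χ with
  | zero => simp [expand]
  | succ j ih =>
    simp only [expand_passed_succ, ih, overlap_checked, sum_const_strings]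
    linear_combination 2 ^ (j + 1) * overlap χ * quarter_pow (nI := nI)

/-- Every check halves the weight orthogonal to the maximally entangled state. -/
lemma expand_passed_normSqAmp (j : ℕ) (χ : Amp nI X) :
    expand (fun h χ => if h then 0 else normSqAmp χ) j false χ =
      (2 ^ j - 1) * (overlap χ / 2 ^ nI) + normSqAmp χ := by
  induction j generalizing χ with
  | zero => simp [expand]
  | succ j ih =>
    have : ∀ u v, 2 * ((2 ^ j - 1) * (overlap (checked u v false χ) / 2 ^ nI) +
        normSqAmp (checked u v false χ)) =
        ((2 * (2 ^ j - 1) * (overlap χ / 2 ^ nI) + normSqAmp χ) * (1 / 4) ^ nI) +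
          (1 / 4) ^ nI * (innerAmp (pauli u v χ) χ).re := by
      intro u v
      rw [overlap_checked, normSqAmp_checked]
      simp only [Bool.false_eq_true, if_false]
      ring
    simp only [expand_passed_succ, ih, this, Finset.sum_add_distrib, ← Finset.mul_sum,
      sum_innerAmp_pauli, sum_const_strings]
    have h2 : (1 / 4 : ℝ) ^ nI * (2 ^ nI * overlap χ) = overlap χ / 2 ^ nI := by
      rw [eq_div_iff (by positivity)]
      have : (4 : ℝ) ^ nI = 2 ^ nI * 2 ^ nI := by rw [← mul_pow]; norm_num
      linear_combination overlap χ * quarter_pow (nI := nI) - (1 / 4 : ℝ) ^ nI * overlap χ * this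
    rw [h2]
    linear_combination (2 * (2 ^ j - 1) * (overlap χ / 2 ^ nI) + normSqAmp χ) *
      quarter_pow (nI := nI)

end Expansion

/-! ### Reduction of a sum over branches to `expand` -/

section Program

variable {nI nK T : ℕ}

/-- All checks. -/
noncomputable def checks (hT : T ≤ nK) : List (Step (numWires nI nK T)) :=
  (List.finRange T).flatMap (check hT)

lemma Fresh.record (hT : T ≤ nK) {k : Fin T} {α : Qubits (numWires nI nK T)} (hα : Fresh k α)
    (u v : Fin nI → Bool) (s : Bool) : Fresh (k + 1) (record hT k u v s α) := by
  intro k' hk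
  have hne : k ≠ k' := by rintro rfl; omega
  obtain ⟨h1, h2, h3⟩ := hα k' (by omega)
  refine ⟨fun j => ?_, fun j => ?_, ?_⟩
  · rw [record_ancilla, shift_apply_not_mem _ _ (by simp),
      shift_apply_not_mem _ _ (by simp [hne.symm]), h1]
  · rw [record_ancilla, shift_apply_not_mem _ _ (by simp [hne.symm]),
      shift_apply_not_mem _ _ (by simp), h2]
  · rw [record_ancilla, shift_syn, h3]

lemma Fresh.recordAlice (hT : T ≤ nK) {k : Fin T} {α : Qubits (numWires nI nK T)}
    (hα : Fresh k α) (u v : Fin nI → Bool) (s : Bool) :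
    Fresh (k + 1) (recordAlice hT k u v s α) := by
  intro k' hk
  have hne : k' ≠ k := by rintro rfl; omega
  obtain ⟨h1, h2, h3⟩ := hα.record hT u v s k' hk
  refine ⟨fun j => ?_, fun j => ?_, ?_⟩
  · rw [recordAlice_of_ne _ _ _ _ _ _ (by simp), h1]
  · rw [recordAlice_of_ne _ _ _ _ _ _ (by simp), h2]
  · rw [recordAlice_of_ne _ _ _ _ _ _ (by simp [hne]), h3]

variable {X : Type*} [Fintype X] {β : Type*} [AddCommMonoid β]

lemma sum_rel {ι : Type*} {R : β → β → Prop} (h0 : R 0 0)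
    (hadd : ∀ a b c d, R a b → R c d → R (a + c) (b + d)) (s : Finset ι) {f g : ι → β}
    (h : ∀ i, R (f i) (g i)) : R (∑ i ∈ s, f i) (∑ i ∈ s, g i) := by
  classical
  induction s using Finset.induction_on with
  | empty => simpa using h0
  | insert i s hi ih =>
    rw [Finset.sum_insert hi, Finset.sum_insert hi]
    exact hadd _ _ _ _ (h i) ih

/-- To relate a sum over the final states to the expansion, it suffices to relate the terms. -/
lemma total_checks {R : β → β → Prop} (h0 : R 0 0)
    (hadd : ∀ a b c d, R a b → R c d → R (a + c) (b + d)) (hT : T ≤ nK) (L : ℕ)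
    (Φ : JointOp (numWires nI nK T) → β) (φ : Bool → Amp nI X → β)
    (hΦ : ∀ α α' χ, R (Φ (stage L T α α' χ * (stage L T α α' χ)ᴴ)) (φ (α (synW (Fin.last T))) χ))
    (χ : Amp nI X) :
    R (total (checks hT) (stage L 0 (fun _ => false) (fun _ => false) χ) Φ)
      (expand φ T false χ) := by
  -- Induction on the number `j` of remaining checks, for arbitrary records that are still zero from
  -- check `k` on. The flag of `expand` is Alice's `k`-th syndrome wire.
  have key : ∀ j k (hk : k + j = T) (α α' : Qubits (numWires nI nK T)) (χ : Amp nI X),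
      Fresh k α → Fresh k α' →
      R (total (((List.finRange T).drop k).flatMap (check hT)) (stage L k α α' χ) Φ)
        (expand φ j (α (synW ⟨k, by omega⟩)) χ) := by
    intro j
    induction j with
    | zero =>
      rintro k hk α α' χ - -
      obtain rfl : k = T := by omega
      rw [List.drop_of_length_le (by simp), List.flatMap_nil, total_nil]
      exact hΦ α α' χ
    | succ j ih =>
      intro k hk α α' χ hα hα'
      have hkT : k < T := by omega
      rw [List.drop_eq_getElem_cons (by simpa using hkT), List.flatMap_cons,
        List.getElem_finRange]
      have hcast : Fin.cast List.length_finRange ⟨k, by simpa using hkT⟩ = (⟨k, hkT⟩ : Fin T) := rfl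
      rw [hcast, total_check hT L ⟨k, hkT⟩ hα hα', expand]
      refine sum_rel h0 hadd _ fun u => sum_rel h0 hadd _ fun v => sum_rel h0 hadd _ fun y =>
        sum_rel h0 hadd _ fun s => ?_
      have hsyn : recordAlice hT ⟨k, hkT⟩ u v s α (synW ⟨k + 1, by omega⟩) =
        (α (synW ⟨k, by omega⟩) || s) := Function.update_self _ _ _
      rw [← hsyn]
      exact ih (k + 1) (by omega) _ _ _ (hα.recordAlice hT (k := ⟨k, hkT⟩) u v s)
        (hα'.record hT (k := ⟨k, hkT⟩) u v y)
  have := key T 0 (by omega) (fun _ => false) (fun _ => false) χ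
    (fun _ _ => ⟨fun _ => rfl, fun _ => rfl, rfl⟩) (fun _ _ => ⟨fun _ => rfl, fun _ => rfl, rfl⟩)
  exact this

end Program

/-! ### Fidelity and trace of a factored state -/

section Fidelity

/-- This is `⟨Ψ| A Aᴴ |Ψ⟩ = ‖Aᴴ Ψ‖²`. -/
lemma fidelity_mul_conjTranspose {T : ℕ} {κ : Type*} [Fintype κ]
    (A : Matrix (Fin T × Fin T) κ ℂ) :
    fidelity (A * Aᴴ) = 1 / T * ∑ k, Complex.normSq (∑ y, A (y, y) k) := by
  have hmul : ∀ k, (Aᴴ *ᵥ maxEnt T) k =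
      ((1 / Real.sqrt T : ℝ) : ℂ) * (starRingEnd ℂ) (∑ y, A (y, y) k) := by
    intro k
    simp only [Matrix.mulVec, dotProduct, Fintype.sum_prod_type, maxEnt, mul_ite, mul_zero,
      Finset.sum_ite_eq, Finset.mem_univ, if_true, Matrix.conjTranspose_apply, map_sum,
      Finset.mul_sum]
    exact Finset.sum_congr rfl fun y _ => mul_comm _ _
  have hstar : star (maxEnt T) ᵥ* A = star (Aᴴ *ᵥ maxEnt T) := by
    rw [Matrix.star_mulVec, Matrix.conjTranspose_conjTranspose]
  rw [fidelity, ← Matrix.mulVec_mulVec, Matrix.dotProduct_mulVec, hstar]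
  simp only [dotProduct, Pi.star_apply, Complex.re_sum, Finset.mul_sum]
  refine Finset.sum_congr rfl fun k _ => ?_
  rw [hmul k, Complex.star_def, ← Complex.normSq_eq_conj_mul_self, Complex.ofReal_re,
    Complex.normSq_mul, Complex.normSq_conj, Complex.normSq_ofReal]
  congr 1
  rw [div_mul_div_comm, Real.mul_self_sqrt (Nat.cast_nonneg T), one_mul]

lemma fidelity_real_smul {T : ℕ} (c : ℝ) (A : Matrix (Fin T × Fin T) (Fin T × Fin T) ℂ) :
    fidelity ((c : ℂ) • A) = c * fidelity A := by
  rw [fidelity, Matrix.smul_mulVec, dotProduct_smul, smul_eq_mul, Complex.re_ofReal_mul]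
  rfl

lemma trace_mul_conjTranspose {ι κ : Type*} [Fintype ι] [Fintype κ] (A : Matrix ι κ ℂ) :
    (A * Aᴴ).trace = ((∑ i, ∑ k, Complex.normSq (A i k) : ℝ) : ℂ) := by
  simp only [Matrix.trace, Matrix.diag_apply, Matrix.mul_apply, Matrix.conjTranspose_apply]
  push_cast
  exact Finset.sum_congr rfl fun i _ => Finset.sum_congr rfl fun k _ => by
    rw [Complex.star_def, Complex.mul_conj]

end Fidelity

lemma bits_injOn {k x y : ℕ} (hx : x < 2 ^ k) (hy : y < 2 ^ k) (h : bits k x = bits k y) :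
    x = y := by
  refine Nat.eq_of_testBit_eq fun i => ?_
  by_cases hi : i < k
  · exact congrFun h ⟨i, hi⟩
  · have hle : 2 ^ k ≤ 2 ^ i := Nat.pow_le_pow_right (by norm_num) (by omega)
    rw [Nat.testBit_lt_two_pow (hx.trans_le hle), Nat.testBit_lt_two_pow (hy.trans_le hle)]

/-! ### The partial trace over the discarded wires -/

namespace Protocol

variable {N K M : ℕ} (P : Protocol N K M)

open Classical in
/-- A label with the output wires erased. -/
noncomputable def erase (a : Qubits P.width) : Qubits P.width :=
  fun i => if i ∈ Set.range P.outWire then false else a i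

lemma agreeOff_iff (a a' : Qubits P.width) : P.AgreeOff a a' ↔ P.erase a = P.erase a' := by
  constructor
  · intro h
    ext i
    by_cases hi : i ∈ Set.range P.outWire
    · simp only [erase, if_pos hi]
    · simp only [erase, if_neg hi]; exact h i hi
  · intro h i hi
    have := congrFun h i
    simpa only [erase, if_neg hi] using this

lemma Reads.unique {P : Protocol N K M} {a : Qubits P.width} {x y : Fin M} (hx : P.Reads a x)
    (hy : P.Reads a y) : x = y := by
  have hM := Nat.le_pow_clog (b := 2) (by norm_num) M
  refine Fin.ext (bits_injOn (x.2.trans_le hM) (y.2.trans_le hM) ?_)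
  ext i
  rw [← hx i, hy i]

lemma Reads.eq_of_erase_eq {P : Protocol N K M} {a a' : Qubits P.width} {x : Fin M}
    (hx : P.Reads a x) (hy : P.Reads a' x) (h : P.erase a = P.erase a') : a = a' := by
  ext i
  by_cases hi : i ∈ Set.range P.outWire
  · obtain ⟨j, rfl⟩ := hi
    rw [hx j, hy j]
  · exact (P.agreeOff_iff a a').2 h i hi

variable {X : Type*}

open Classical in
/-- A factor of the output state: the partial trace becomes a sum over the erased labels. -/
noncomputable def outAmp (ψ : Matrix (Qubits P.width × Qubits P.width) X ℂ) :
    Matrix (Fin M × Fin M) ((Qubits P.width × Qubits P.width) × X) ℂ := fun r d =>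
  ∑ q : Qubits P.width × Qubits P.width,
    if P.Reads q.1 r.1 ∧ P.Reads q.2 r.2 ∧ (P.erase q.1, P.erase q.2) = d.1 then ψ q d.2 else 0

open Classical in
lemma sum_outAmp (ψ : Matrix (Qubits P.width × Qubits P.width) X ℂ)
    (D : Finset (Qubits P.width × Qubits P.width)) (x : X) :
    ∑ d ∈ D, ∑ y, P.outAmp ψ (y, y) (d, x) =
      ∑ q, (∑ d ∈ D, ∑ y, if P.Reads q.1 y ∧ P.Reads q.2 y ∧
        (P.erase q.1, P.erase q.2) = d then (1 : ℂ) else 0) * ψ q x := by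
  simp only [outAmp, Finset.sum_mul, ite_mul, one_mul, zero_mul]
  rw [Finset.sum_comm (s := (Finset.univ : Finset (Qubits P.width × Qubits P.width))) (t := D)]
  refine Finset.sum_congr rfl fun d _ => ?_
  rw [Finset.sum_comm]

variable [Fintype X]

lemma readOut_mul_conjTranspose (ψ : Matrix (Qubits P.width × Qubits P.width) X ℂ) :
    P.readOut (ψ * ψᴴ) = P.outAmp ψ * (P.outAmp ψ)ᴴ := by
  classical
  ext r s
  simp only [readOut, Matrix.mul_apply, Matrix.conjTranspose_apply, outAmp, star_sum,
    Finset.sum_mul_sum]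
  symm
  rw [Finset.sum_comm]
  refine Finset.sum_congr rfl fun q _ => ?_
  rw [Finset.sum_comm]
  refine Finset.sum_congr rfl fun q' _ => ?_
  rw [Fintype.sum_prod_type, Finset.sum_eq_single (P.erase q.1, P.erase q.2)]
  · simp only [P.agreeOff_iff, and_true, Prod.mk.injEq]
    by_cases h1 : P.Reads q.1 r.1 ∧ P.Reads q.2 r.2
    · by_cases h2 : P.Reads q'.1 s.1 ∧ P.Reads q'.2 s.2 ∧
        (P.erase q'.1 = P.erase q.1 ∧ P.erase q'.2 = P.erase q.2)
      · rw [if_pos ⟨h1.1, h1.2, h2.1, h2.2.1, h2.2.2.1.symm, h2.2.2.2.symm⟩]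
        refine Finset.sum_congr rfl fun x _ => ?_
        rw [if_pos h1, if_pos h2]
      · rw [if_neg fun h => h2 ⟨h.2.2.1, h.2.2.2.1, h.2.2.2.2.1.symm, h.2.2.2.2.2.symm⟩]
        refine Finset.sum_eq_zero fun x _ => ?_
        rw [if_neg h2, star_zero, mul_zero]
    · rw [if_neg fun h => h1 ⟨h.1, h.2.1⟩]
      refine Finset.sum_eq_zero fun x _ => ?_
      rw [if_neg h1, zero_mul]
  · intro d _ hd
    refine Finset.sum_eq_zero fun x _ => ?_
    rw [if_neg fun h => hd h.2.2.symm, zero_mul]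
  · simp

/-- A label is determined by what is read from it and by its erased version, so a diagonal entry of
the output only collects terms with `q = q'`. By `hψ` no weight lies on strings that encode no
number below `M`. -/
lemma trace_readOut (ψ : Matrix (Qubits P.width × Qubits P.width) X ℂ)
    (hψ : ∀ q x, ψ q x ≠ 0 → ∃ r : Fin M × Fin M, P.Reads q.1 r.1 ∧ P.Reads q.2 r.2) :
    (P.readOut (ψ * ψᴴ)).trace = (ψ * ψᴴ).trace := by
  classical
  simp only [Matrix.trace, Matrix.diag_apply, readOut]
  rw [Finset.sum_comm]
  refine Finset.sum_congr rfl fun q _ => ?_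
  by_cases hq : ∃ r : Fin M × Fin M, P.Reads q.1 r.1 ∧ P.Reads q.2 r.2
  · obtain ⟨r, h1, h2⟩ := hq
    rw [Finset.sum_eq_single r, Finset.sum_eq_single q]
    · rw [if_pos ⟨h1, h2, h1, h2, fun _ _ => rfl, fun _ _ => rfl⟩]
    · intro q' _ hne
      refine if_neg fun h => hne ?_
      exact Prod.ext (h.2.2.1.eq_of_erase_eq h1 ((P.agreeOff_iff _ _).1 h.2.2.2.2.1).symm)
        (h.2.2.2.1.eq_of_erase_eq h2 ((P.agreeOff_iff _ _).1 h.2.2.2.2.2).symm)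
    · simp
    · intro r' _ hne
      refine Finset.sum_eq_zero fun q' _ => if_neg fun h => hne ?_
      exact Prod.ext (h.1.unique h1) (h.2.1.unique h2)
    · simp
  · have h0 : ∀ x, ψ q x = 0 := fun x => by
      by_contra h; exact hq (hψ q x h)
    rw [Matrix.mul_apply]
    simp only [h0, zero_mul, Finset.sum_const_zero]
    exact Finset.sum_eq_zero fun r _ => Finset.sum_eq_zero fun q' _ =>
      if_neg fun h => hq ⟨r, h.1, h.2.1⟩

lemma isState_readOut (ψ : Matrix (Qubits P.width × Qubits P.width) X ℂ)
    (hψ : ∀ q x, ψ q x ≠ 0 → ∃ r : Fin M × Fin M, P.Reads q.1 r.1 ∧ P.Reads q.2 r.2)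
    (h0 : (ψ * ψᴴ).trace.re ≠ 0) :
    IsState ((ψ * ψᴴ).trace⁻¹ • P.readOut (ψ * ψᴴ)) := by
  have htr := trace_mul_conjTranspose ψ
  have hne : (ψ * ψᴴ).trace ≠ 0 := fun h => h0 (by rw [h]; rfl)
  constructor
  · rw [readOut_mul_conjTranspose]
    refine (Matrix.posSemidef_self_mul_conjTranspose _).smul ?_
    rw [htr, ← Complex.ofReal_inv, Complex.zero_le_real, inv_nonneg]
    exact Finset.sum_nonneg fun _ _ => Finset.sum_nonneg fun _ _ => Complex.normSq_nonneg _
  · rw [Matrix.trace_smul, P.trace_readOut ψ hψ, smul_eq_mul, inv_mul_cancel₀ hne]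

lemma fidelity_readOut_nonneg (ψ : Matrix (Qubits P.width × Qubits P.width) X ℂ) :
    0 ≤ fidelity (P.readOut (ψ * ψᴴ)) := by
  rw [readOut_mul_conjTranspose, fidelity_mul_conjTranspose]
  exact mul_nonneg (by positivity) (Finset.sum_nonneg fun _ _ => Complex.normSq_nonneg _)

/-- Any set of erased labels gives a lower bound on the fidelity of the output. -/
lemma le_fidelity_readOut (ψ : Matrix (Qubits P.width × Qubits P.width) X ℂ)
    (D : Finset (Qubits P.width × Qubits P.width)) :
    ∑ x, Complex.normSq (∑ d ∈ D, ∑ y, P.outAmp ψ (y, y) (d, x)) ≤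
      D.card * (M * fidelity (P.readOut (ψ * ψᴴ))) := by
  rcases Nat.eq_zero_or_pos M with rfl | hM
  · simp
  have hM' : (M : ℝ) ≠ 0 := by exact_mod_cast hM.ne'
  rw [readOut_mul_conjTranspose, fidelity_mul_conjTranspose, Fintype.sum_prod_type,
    Finset.sum_comm, ← mul_assoc (M : ℝ), mul_one_div_cancel hM', one_mul, Finset.mul_sum]
  -- Cauchy–Schwarz over `D`; the terms outside `D` are nonnegative.
  refine Finset.sum_le_sum fun x _ => (normSq_sum_le _ _).trans ?_
  refine mul_le_mul_of_nonneg_left ?_ (Nat.cast_nonneg _)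
  exact Finset.sum_le_sum_of_subset_of_nonneg (Finset.subset_univ _)
    fun _ _ _ => Complex.normSq_nonneg _

end Protocol

/-- A number below `2^k * L` consists of `k` free low-order bits and a number below `L`, even if `L`
is not a power of two. This splits `Ψ_K` into EPR pairs and `Ψ_L`, and the output register into
input pairs and `Ψ_L`. -/
lemma clog_two_pow_mul (k : ℕ) {L : ℕ} (hL : 0 < L) :
    Nat.clog 2 (2 ^ k * L) = k + Nat.clog 2 L := by
  refine le_antisymm ?_ ?_
  · refine Nat.clog_le_of_le_pow ?_
    rw [pow_add]
    exact Nat.mul_le_mul_left _ (Nat.le_pow_clog (by norm_num) L)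
  · have h := Nat.le_pow_clog (b := 2) (by norm_num) (2 ^ k * L)
    have hk : k ≤ Nat.clog 2 (2 ^ k * L) := by
      rw [← Nat.pow_le_pow_iff_right (a := 2) (by norm_num)]
      exact (Nat.le_mul_of_pos_right _ hL).trans h
    obtain ⟨j, hj⟩ := Nat.exists_eq_add_of_le hk
    rw [hj, pow_add] at h
    rw [hj]
    exact Nat.add_le_add_left (Nat.clog_le_of_le_pow (Nat.le_of_mul_le_mul_left h (by positivity))) k

/-! ### The support of a final state -/

section Labels

variable {nI nK T : ℕ}

/-- The label with input `p`, the binary representation of `l` on the auxiliary wires from number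
`T` on, and `α` elsewhere. -/
noncomputable def mkLabel (α : Qubits (numWires nI nK T)) (p : Fin nI → Bool) (l : ℕ) :
    Qubits (numWires nI nK T) := fun c =>
  match wire.symm c with
  | .inl (.inl j) => p j
  | .inl (.inr i) => if T ≤ (i : ℕ) then l.testBit (i - T) else α c
  | .inr _ => α c

lemma mkLabel_in (α : Qubits (numWires nI nK T)) (p : Fin nI → Bool) (l : ℕ) (j : Fin nI) :
    mkLabel α p l (inW j) = p j := by
  simp [mkLabel]

lemma mkLabel_aux (α : Qubits (numWires nI nK T)) (p : Fin nI → Bool) (l : ℕ) (i : Fin nK) :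
    mkLabel α p l (auxW i) = if T ≤ (i : ℕ) then l.testBit (i - T) else α (auxW i) := by
  simp [mkLabel]

lemma mkLabel_ancilla (α : Qubits (numWires nI nK T)) (p : Fin nI → Bool) (l : ℕ) (y) :
    mkLabel α p l (wire (.inr y)) = α (wire (.inr y)) := by
  simp [mkLabel]

lemma label_ext {a b : Qubits (numWires nI nK T)} (h1 : ∀ j, a (inW j) = b (inW j))
    (h2 : ∀ i, a (auxW i) = b (auxW i)) (h3 : ∀ y, a (wire (.inr y)) = b (wire (.inr y))) :
    a = b := by
  ext c
  obtain ⟨x, rfl⟩ := wire.surjective c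
  rcases x with (j | i) | y
  · exact h1 j
  · exact h2 i
  · exact h3 y

/-- Once all checks are done, the only freedom left is each party's input string and the common
register value `l`. -/
lemma match_iff_mkLabel {L : ℕ} {α β a b : Qubits (numWires nI nK T)} :
    Match L T α β a b ↔ ∃ l < L, a = mkLabel α (fun j => a (inW j)) l ∧
      b = mkLabel β (fun j => b (inW j)) l := by
  constructor
  · rintro ⟨h1, h2, h3, l, hl, h4⟩
    refine ⟨l, hl, label_ext (fun j => by rw [mkLabel_in]) (fun i => ?_) fun y => ?_,
      label_ext (fun j => by rw [mkLabel_in]) (fun i => ?_) fun y => ?_⟩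
    · rw [mkLabel_aux]
      split_ifs with hi
      · exact h4 i hi
      · exact (h1 i (by omega)).1
    · rw [mkLabel_ancilla, (h2 y).1]
    · rw [mkLabel_aux]
      split_ifs with hi
      · rw [← h3 i hi, h4 i hi]
      · exact (h1 i (by omega)).2
    · rw [mkLabel_ancilla, (h2 y).2]
  · rintro ⟨l, hl, ha, hb⟩
    refine ⟨fun i hi => ⟨?_, ?_⟩, fun y => ⟨?_, ?_⟩, fun i hi => ?_, l, hl, fun i hi => ?_⟩
    · rw [ha, mkLabel_aux, if_neg (by omega)]
    · rw [hb, mkLabel_aux, if_neg (by omega)]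
    · rw [ha, mkLabel_ancilla]
    · rw [hb, mkLabel_ancilla]
    · rw [ha, hb, mkLabel_aux, mkLabel_aux, if_pos hi, if_pos hi]
    · rw [ha, mkLabel_aux, if_pos hi]

lemma mkLabel_injOn {L : ℕ} (hL : L ≤ 2 ^ (nK - T)) {α : Qubits (numWires nI nK T)}
    {p p' : Fin nI → Bool} {l l' : ℕ} (hl : l < L) (hl' : l' < L)
    (h : mkLabel α p l = mkLabel α p' l') : p = p' ∧ l = l' := by
  refine ⟨?_, bits_injOn (hl.trans_le hL) (hl'.trans_le hL) ?_⟩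
  · ext j
    rw [← mkLabel_in α p l, h, mkLabel_in]
  · ext i
    have hi := i.2
    have := congrFun h (auxW ⟨i + T, by omega⟩)
    rwa [mkLabel_aux, mkLabel_aux, if_pos (by simp), if_pos (by simp), Nat.add_sub_cancel] at this

variable {X : Type*}

/-- Sums over the support of a final state. -/
lemma sum_stage {γ : Type*} [AddCommMonoid γ] {L : ℕ} (hL : L ≤ 2 ^ (nK - T))
    (α β : Qubits (numWires nI nK T)) (χ : Amp nI X) (x : X)
    (f : Qubits (numWires nI nK T) × Qubits (numWires nI nK T) → ℂ → γ) (hf : ∀ q, f q 0 = 0) :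
    ∑ q, f q (stage L T α β χ q x) =
      ∑ p, ∑ p', ∑ l : Fin L, f (mkLabel α p l, mkLabel β p' l) (χ p p' x) := by
  classical
  have hinj : Function.Injective
      fun r : (Fin nI → Bool) × (Fin nI → Bool) × Fin L =>
        ((mkLabel α r.1 r.2.2, mkLabel β r.2.1 r.2.2) :
          Qubits (numWires nI nK T) × Qubits (numWires nI nK T)) := by
    rintro ⟨p, p', l⟩ ⟨r, r', l'⟩ h
    simp only [Prod.mk.injEq] at h
    obtain ⟨h1, h2⟩ := mkLabel_injOn hL l.2 l'.2 h.1
    obtain ⟨h3, -⟩ := mkLabel_injOn hL l.2 l'.2 h.2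
    simp only [h1, h3, Fin.ext h2]
  symm
  have := Fintype.sum_of_injective _ hinj
    (fun r => f (mkLabel α r.1 r.2.2, mkLabel β r.2.1 r.2.2) (χ r.1 r.2.1 x))
    (fun q => f q (stage L T α β χ q x)) ?_ ?_
  · simpa only [Fintype.sum_prod_type] using this
  · rintro ⟨a, b⟩ hq
    rw [stage_eq_zero, hf]
    intro hM
    obtain ⟨l, hl, ha, hb⟩ := match_iff_mkLabel.1 hM
    exact hq ⟨(_, _, ⟨l, hl⟩), Prod.ext ha.symm hb.symm⟩
  · rintro ⟨p, p', l⟩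
    have hM : Match L T α β (mkLabel α p l) (mkLabel β p' l) :=
      match_iff_mkLabel.2 ⟨l, l.2, by simp only [mkLabel_in], by simp only [mkLabel_in]⟩
    simp only [stage, if_pos hM, mkLabel_in]

variable [Fintype X]

/-- The `L` values of the register are orthogonal and carry the same amplitudes `χ`. -/
lemma trace_stage {L : ℕ} (hL : L ≤ 2 ^ (nK - T)) (α β : Qubits (numWires nI nK T))
    (χ : Amp nI X) :
    (stage L T α β χ * (stage L T α β χ)ᴴ).trace = ((L * normSqAmp χ : ℝ) : ℂ) := by
  rw [trace_mul_conjTranspose, Finset.sum_comm]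
  simp only [fun x => sum_stage hL α β χ x (fun _ z => Complex.normSq z) fun _ => map_zero _]
  congr 1
  rw [Finset.sum_comm, normSqAmp, Finset.mul_sum]
  refine Finset.sum_congr rfl fun p _ => ?_
  rw [Finset.sum_comm, Finset.mul_sum]
  refine Finset.sum_congr rfl fun q _ => ?_
  simp [Finset.mul_sum]

end Labels

/-! ### The protocol, its output, and the fidelity after discarding wires -/

section Purification

variable {m t L u : ℕ}

lemma clog_aux (t : ℕ) (hL : 0 < L) : Nat.clog 2 (L * 2 ^ (2 * t)) = 2 * t + Nat.clog 2 L := by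
  rw [mul_comm, clog_two_pow_mul _ hL]

lemma two_mul_le_clog (t : ℕ) (hL : 0 < L) : 2 * t ≤ Nat.clog 2 (L * 2 ^ (2 * t)) := by
  rw [clog_aux t hL]; omega

lemma le_two_pow_clog_sub (t : ℕ) (hL : 0 < L) :
    L ≤ 2 ^ (Nat.clog 2 (L * 2 ^ (2 * t)) - 2 * t) := by
  rw [clog_aux t hL, Nat.add_sub_cancel_left]
  exact Nat.le_pow_clog (by norm_num) L

/-- The output wires: the first `u` input wires and the unused auxiliary wires. -/
noncomputable def outputWire (hu : u ≤ m) (hL : 0 < L) (i : Fin (Nat.clog 2 (2 ^ u * L))) :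
    Fin (numWires (Nat.clog 2 (2 ^ m)) (Nat.clog 2 (L * 2 ^ (2 * t))) (2 * t)) :=
  if h : (i : ℕ) < u then inW ⟨i, by rw [Nat.clog_pow _ _ (by norm_num)]; omega⟩
  else auxW ⟨2 * t + (i - u), by
    have h1 := i.2
    have h2 := clog_two_pow_mul u hL
    have h3 := clog_aux t hL
    omega⟩

lemma outputWire_injective (hu : u ≤ m) (hL : 0 < L) :
    Function.Injective (outputWire (t := t) hu hL) := by
  intro i j h
  simp only [outputWire] at h
  split_ifs at h with h1 h2 h2
  · simpa [Fin.ext_iff] using h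
  · simp at h
  · simp at h
  · simp [Fin.ext_iff] at h
    exact Fin.ext (by omega)

/-- Random checks with the auxiliary pairs, which leave the input and the register of dimension
`L` intact; the output consists of `u` of the input wires and that register. -/
noncomputable abbrev purification (m t L u : ℕ) (hu : u ≤ m) (hL : 0 < L) :
    Protocol (2 ^ m) (L * 2 ^ (2 * t)) (2 ^ u * L) where
  width := numWires (Nat.clog 2 (2 ^ m)) (Nat.clog 2 (L * 2 ^ (2 * t))) (2 * t)
  wires := ⟨fun x => wire (.inl x), fun x y h => by simpa using h⟩
  outWire := ⟨outputWire hu hL, outputWire_injective hu hL⟩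
  failWire := synW (Fin.last (2 * t))
  program := checks (two_mul_le_clog t hL)

/-- The output read from a label. -/
def encode (hu : u ≤ m) (p : Fin (Nat.clog 2 (2 ^ m)) → Bool) (l : Fin L) : Fin (2 ^ u * L) :=
  ⟨2 ^ u * l + Nat.ofBits fun j : Fin u => p ⟨j, by rw [Nat.clog_pow _ _ (by norm_num)]; omega⟩, by
    have h1 := Nat.ofBits_lt_two_pow
      fun j : Fin u => p ⟨j, by rw [Nat.clog_pow _ _ (by norm_num)]; omega⟩
    have h2 := l.2
    calc _ < 2 ^ u * (l : ℕ) + 2 ^ u := by omega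
      _ = 2 ^ u * ((l : ℕ) + 1) := by ring
      _ ≤ _ := Nat.mul_le_mul_left _ h2⟩

variable (hu : u ≤ m) (hL : 0 < L)

lemma reads_mkLabel (α : Qubits (purification m t L u hu hL).width)
    (p : Fin (Nat.clog 2 (2 ^ m)) → Bool) (l : Fin L) :
    (purification m t L u hu hL).Reads (mkLabel α p l) (encode hu p l) := by
  intro i
  change mkLabel α p l (outputWire hu hL i) = (encode hu p l : ℕ).testBit i
  rw [encode, Nat.testBit_two_pow_mul_add _ (Nat.ofBits_lt_two_pow _), outputWire]
  split_ifs with h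
  · rw [mkLabel_in, Nat.testBit_ofBits_lt _ _ h]
  · rw [mkLabel_aux, if_pos (by simp)]
    simp

lemma encode_bit (p : Fin (Nat.clog 2 (2 ^ m)) → Bool) (l : Fin L)
    (j : Fin (Nat.clog 2 (2 ^ m))) (hj : (j : ℕ) < u) :
    (encode hu p l : ℕ).testBit j = p j := by
  rw [encode, Nat.testBit_two_pow_mul_add _ (Nat.ofBits_lt_two_pow _), if_pos hj,
    Nat.testBit_ofBits_lt _ _ hj]

lemma inW_not_mem_range {j : Fin (Nat.clog 2 (2 ^ m))} (hj : u ≤ (j : ℕ)) :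
    (inW j : Fin (purification m t L u hu hL).width) ∉
      Set.range (purification m t L u hu hL).outWire := by
  rintro ⟨i, hi⟩
  change outputWire hu hL i = inW j at hi
  simp only [outputWire] at hi
  split_ifs at hi with h
  · simp [Fin.ext_iff] at hi
    omega
  · simp at hi

lemma inW_mem_range {j : Fin (Nat.clog 2 (2 ^ m))} (hj : (j : ℕ) < u) :
    (inW j : Fin (purification m t L u hu hL).width) ∈
      Set.range (purification m t L u hu hL).outWire := by
  refine ⟨⟨j, by rw [clog_two_pow_mul u hL]; omega⟩, ?_⟩
  change outputWire hu hL _ = _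
  simp only [outputWire, dif_pos hj]

lemma auxW_mem_range {i : Fin (Nat.clog 2 (L * 2 ^ (2 * t)))} (hi : 2 * t ≤ (i : ℕ)) :
    (auxW i : Fin (purification m t L u hu hL).width) ∈
      Set.range (purification m t L u hu hL).outWire := by
  have h := i.2
  have h' := clog_aux t hL
  refine ⟨⟨u + (i - 2 * t), by rw [clog_two_pow_mul u hL]; omega⟩, ?_⟩
  change outputWire hu hL _ = _
  simp only [outputWire]
  rw [dif_neg (by simp)]
  exact congrArg auxW (Fin.ext (by change 2 * t + (u + (i - 2 * t) - u) = (i : ℕ); omega))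

lemma erase_mkLabel_in {α : Qubits (purification m t L u hu hL).width}
    {p p' : Fin (Nat.clog 2 (2 ^ m)) → Bool} {l l' : ℕ}
    (h : (purification m t L u hu hL).erase (mkLabel α p l) =
      (purification m t L u hu hL).erase (mkLabel α p' l'))
    {j : Fin (Nat.clog 2 (2 ^ m))} (hj : u ≤ (j : ℕ)) : p j = p' j := by
  have := congrFun h (inW j)
  simp only [Protocol.erase, if_neg (inW_not_mem_range hu hL hj)] at this
  rw [← mkLabel_in α p l j, ← mkLabel_in α p' l' j]
  exact this

lemma erase_mkLabel_congr (α : Qubits (purification m t L u hu hL).width)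
    {p p' : Fin (Nat.clog 2 (2 ^ m)) → Bool} (l l' : ℕ)
    (h : ∀ j : Fin (Nat.clog 2 (2 ^ m)), u ≤ (j : ℕ) → p j = p' j) :
    (purification m t L u hu hL).erase (mkLabel α p l) =
      (purification m t L u hu hL).erase (mkLabel α p' l') := by
  refine label_ext (fun j => ?_) (fun i => ?_) fun y => ?_
  · by_cases hj : (j : ℕ) < u
    · simp only [Protocol.erase, if_pos (inW_mem_range hu hL hj)]
    · simp only [Protocol.erase, if_neg (inW_not_mem_range hu hL (not_lt.1 hj))]
      exact (mkLabel_in α p l j).trans ((h j (not_lt.1 hj)).trans (mkLabel_in α p' l' j).symm)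
  · by_cases hi : 2 * t ≤ (i : ℕ)
    · simp only [Protocol.erase, if_pos (auxW_mem_range hu hL hi)]
    · unfold Protocol.erase
      congr 1
      refine (mkLabel_aux α p l i).trans (Eq.trans ?_ (mkLabel_aux α p' l' i).symm)
      rw [if_neg hi, if_neg hi]
  · unfold Protocol.erase
    congr 1
    exact (mkLabel_ancilla α p l y).trans (mkLabel_ancilla α p' l' y).symm

variable {X : Type*}

lemma reads_of_stage_ne_zero (α β : Qubits (purification m t L u hu hL).width)
    (χ : Amp (Nat.clog 2 (2 ^ m)) X) (q) (x : X) (h : stage L (2 * t) α β χ q x ≠ 0) :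
    ∃ r : Fin (2 ^ u * L) × Fin (2 ^ u * L),
      (purification m t L u hu hL).Reads q.1 r.1 ∧ (purification m t L u hu hL).Reads q.2 r.2 := by
  obtain ⟨a, b⟩ := q
  by_cases hM : Match L (2 * t) α β a b
  · obtain ⟨l, hl, ha, hb⟩ := match_iff_mkLabel.1 hM
    refine ⟨(encode hu (fun j => a (inW j)) ⟨l, hl⟩, encode hu (fun j => b (inW j)) ⟨l, hl⟩),
      ?_, ?_⟩
    · have := reads_mkLabel hu hL α (fun j => a (inW j)) ⟨l, hl⟩
      rwa [← ha] at this
    · have := reads_mkLabel hu hL β (fun j => b (inW j)) ⟨l, hl⟩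
      rwa [← hb] at this
  · exact absurd (stage_eq_zero hM) h

open Classical in
/-- The erased labels of perfectly correlated inputs. -/
noncomputable def correlated (α β : Qubits (purification m t L u hu hL).width) :
    Finset (Qubits (purification m t L u hu hL).width × Qubits (purification m t L u hu hL).width) :=
  Finset.univ.image fun h : Fin (m - u) → Bool =>
    let p : Fin (Nat.clog 2 (2 ^ m)) → Bool := fun j =>
      if hj : u ≤ (j : ℕ) then h ⟨j - u, by
        have h1 := j.2
        have h2 := Nat.clog_pow 2 m (by norm_num)
        omega⟩ else false
    ((purification m t L u hu hL).erase (mkLabel α p 0),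
      (purification m t L u hu hL).erase (mkLabel β p 0))

lemma card_correlated_le (α β : Qubits (purification m t L u hu hL).width) :
    (correlated hu hL α β).card ≤ 2 ^ (m - u) := by
  classical
  refine Finset.card_image_le.trans ?_
  simp

lemma mem_correlated_iff (α β : Qubits (purification m t L u hu hL).width)
    (p q : Fin (Nat.clog 2 (2 ^ m)) → Bool) (l : ℕ) :
    ((purification m t L u hu hL).erase (mkLabel α p l),
      (purification m t L u hu hL).erase (mkLabel β q l)) ∈ correlated hu hL α β ↔
      ∀ j : Fin (Nat.clog 2 (2 ^ m)), u ≤ (j : ℕ) → p j = q j := by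
  classical
  simp only [correlated, Finset.mem_image, Finset.mem_univ, true_and, Prod.mk.injEq]
  constructor
  · rintro ⟨h, h1, h2⟩ j hj
    exact (erase_mkLabel_in hu hL h1 hj).symm.trans (erase_mkLabel_in hu hL h2 hj)
  · intro h
    refine ⟨fun i => p ⟨u + i, by rw [Nat.clog_pow _ _ (by norm_num)]; omega⟩,
      erase_mkLabel_congr hu hL α _ _ fun j hj => ?_,
      erase_mkLabel_congr hu hL β _ _ fun j hj => ?_⟩
    · simp only [hj, dif_pos]
      congr 1
      exact Fin.ext (by simp; omega)
    · simp only [hj, dif_pos]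
      rw [← h j hj]
      congr 1
      exact Fin.ext (by simp; omega)

/-- A term `(p, q, l)` counts exactly if both parties read the same number and their discarded input
bits agree, that is, if `p = q`. The sum over `l` gives the factor `L`. -/
lemma sum_outAmp_correlated (α β : Qubits (purification m t L u hu hL).width)
    (χ : Amp (Nat.clog 2 (2 ^ m)) X) (x : X) :
    ∑ d ∈ correlated hu hL α β, ∑ y,
      (purification m t L u hu hL).outAmp (stage L (2 * t) α β χ) (y, y) (d, x) =
      L * ∑ p, χ p p x := by
  classical
  rw [Protocol.sum_outAmp, sum_stage (le_two_pow_clog_sub t hL) α β χ x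
    (fun q z => (∑ d ∈ correlated hu hL α β, ∑ y,
      if (purification m t L u hu hL).Reads q.1 y ∧ (purification m t L u hu hL).Reads q.2 y ∧
        ((purification m t L u hu hL).erase q.1, (purification m t L u hu hL).erase q.2) = d
      then (1 : ℂ) else 0) * z) (fun _ => mul_zero _)]
  have hcoef : ∀ (p q : Fin (Nat.clog 2 (2 ^ m)) → Bool) (l : Fin L),
      (∑ d ∈ correlated hu hL α β, ∑ y,
        if (purification m t L u hu hL).Reads (mkLabel α p l) y ∧
          (purification m t L u hu hL).Reads (mkLabel β q l) y ∧
          ((purification m t L u hu hL).erase (mkLabel α p l),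
            (purification m t L u hu hL).erase (mkLabel β q l)) = d then (1 : ℂ) else 0) =
      if p = q then 1 else 0 := by
    intro p q l
    split_ifs with hpq
    · subst hpq
      rw [Finset.sum_eq_single_of_mem _ ((mem_correlated_iff hu hL α β p p l).2 fun _ _ => rfl),
        Finset.sum_eq_single (encode hu p l)]
      · exact if_pos ⟨reads_mkLabel hu hL α p l, reads_mkLabel hu hL β p l, rfl⟩
      · intro y _ hy
        exact if_neg fun h => hy (h.1.unique (reads_mkLabel hu hL α p l))
      · simp
      · intro d _ hd
        exact Finset.sum_eq_zero fun y _ => if_neg fun h => hd h.2.2.symm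
    · refine Finset.sum_eq_zero fun d hd => Finset.sum_eq_zero fun y _ => if_neg fun h => hpq ?_
      obtain ⟨h1, h2, rfl⟩ := h
      have h3 := (mem_correlated_iff hu hL α β p q l).1 hd
      have h4 : encode hu p l = encode hu q l :=
        ((reads_mkLabel hu hL α p l).unique h1).trans ((reads_mkLabel hu hL β q l).unique h2).symm
      ext j
      by_cases hj : u ≤ (j : ℕ)
      · exact h3 j hj
      · rw [← encode_bit hu p l j (by omega), h4, encode_bit hu q l j (by omega)]
  simp only [hcoef, ite_mul, one_mul, zero_mul, Finset.sum_const, Finset.card_univ,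
    Fintype.card_fin, nsmul_eq_mul, mul_ite, mul_zero, Finset.sum_ite_eq, Finset.mem_univ,
    if_true, Finset.mul_sum]

variable [Fintype X]

/-- Discarding wires does not decrease the fidelity. -/
lemma fidelity_readOut_stage (α β : Qubits (purification m t L u hu hL).width)
    (χ : Amp (Nat.clog 2 (2 ^ m)) X) :
    L * (overlap χ / 2 ^ m) ≤ fidelity ((purification m t L u hu hL).readOut
      (stage L (2 * t) α β χ * (stage L (2 * t) α β χ)ᴴ)) := by
  have h := (purification m t L u hu hL).le_fidelity_readOut (stage L (2 * t) α β χ)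
    (correlated hu hL α β)
  simp only [sum_outAmp_correlated, Complex.normSq_mul, Complex.normSq_natCast,
    ← Finset.mul_sum] at h
  change (L : ℝ) * L * overlap χ ≤ _ at h
  set F := fidelity ((purification m t L u hu hL).readOut
    (stage L (2 * t) α β χ * (stage L (2 * t) α β χ)ᴴ))
  have hcard : ((correlated hu hL α β).card : ℝ) ≤ 2 ^ (m - u) := by
    exact_mod_cast card_correlated_le hu hL α β
  have hL' : (0 : ℝ) < L := by exact_mod_cast hL
  have hm : (2 : ℝ) ^ m = 2 ^ (m - u) * 2 ^ u := by rw [← pow_add, Nat.sub_add_cancel hu]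
  have hF : 0 ≤ F := Protocol.fidelity_readOut_nonneg _ _
  -- The at most `2^(m-u)` correlated discarded strings and the output dimension `2^u * L` multiply
  -- to `2^m * L`, against `L^2` on the left.
  have h2 : (L : ℝ) * L * overlap χ ≤ 2 ^ (m - u) * (2 ^ u * L * F) := by
    refine h.trans ?_
    push_cast
    gcongr
  rw [mul_div_assoc', div_le_iff₀ (by positivity), hm]
  refine le_of_mul_le_mul_left ?_ hL'
  linarith

end Purification

/-! ### The initial state satisfies the invariant -/

section Initial

variable {m t L u : ℕ} (hu : u ≤ m) (hL : 0 < L)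

/-- The numbers below `2 ^ m` as bit strings. -/
noncomputable def bitsEquiv (m : ℕ) : Fin (2 ^ m) ≃ (Fin (Nat.clog 2 (2 ^ m)) → Bool) :=
  Equiv.ofBijective (fun x => bits (Nat.clog 2 (2 ^ m)) x) <| by
    have hm := Nat.clog_pow 2 m (by norm_num)
    rw [Fintype.bijective_iff_injective_and_card]
    refine ⟨fun x y h => Fin.ext (bits_injOn ?_ ?_ h), by simp [hm]⟩
    · exact x.2.trans_eq (by rw [hm])
    · exact y.2.trans_eq (by rw [hm])

lemma load_eq_iff (x : Fin (2 ^ m)) (y : Fin (L * 2 ^ (2 * t)))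
    (a : Qubits (purification m t L u hu hL).width) :
    a = (purification m t L u hu hL).load x y ↔ (fun j => a (inW j)) = bitsEquiv m x ∧
      (∀ i, a (auxW i) = bits (Nat.clog 2 (L * 2 ^ (2 * t))) y i) ∧
      ∀ z, a (wire (.inr z)) = false := by
  have hin : ∀ j, (purification m t L u hu hL).load x y (inW j) = bitsEquiv m x j := fun j =>
    (purification m t L u hu hL).wires.injective.extend_apply _ _ (.inl j)
  have haux : ∀ i, (purification m t L u hu hL).load x y (auxW i) =
      bits (Nat.clog 2 (L * 2 ^ (2 * t))) y i := fun i =>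
    (purification m t L u hu hL).wires.injective.extend_apply _ _ (.inr i)
  have hanc : ∀ z, (purification m t L u hu hL).load x y (wire (.inr z)) = false := fun z =>
    Function.extend_apply' _ _ _ (by
      rintro ⟨w, hw⟩
      exact absurd (wire.injective hw) (by simp))
  constructor
  · rintro rfl
    exact ⟨funext hin, haux, hanc⟩
  · rintro ⟨h1, h2, h3⟩
    refine label_ext (fun j => ?_) (fun i => ?_) fun z => ?_
    · rw [hin, ← h1]
    · rw [haux, h2]
    · rw [hanc, h3]

lemma exists_aux_iff (hL : 0 < L)
    (f : Fin (Nat.clog 2 (L * 2 ^ (2 * t))) → Bool) :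
    (∃ l < L, ∀ i : Fin (Nat.clog 2 (L * 2 ^ (2 * t))), 2 * t ≤ (i : ℕ) →
      f i = l.testBit (i - 2 * t)) ↔
    ∃ y : Fin (L * 2 ^ (2 * t)), ∀ i, f i = bits _ y i := by
  constructor
  · rintro ⟨l, hl, h⟩
    have hT := two_mul_le_clog t hL
    have hlow := Nat.ofBits_lt_two_pow fun i : Fin (2 * t) => f (i.castLE hT)
    refine ⟨⟨2 ^ (2 * t) * l + Nat.ofBits fun i : Fin (2 * t) => f (i.castLE hT), ?_⟩,
      fun i => ?_⟩
    · calc _ < 2 ^ (2 * t) * l + 2 ^ (2 * t) := by omega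
        _ = (l + 1) * 2 ^ (2 * t) := by ring
        _ ≤ _ := Nat.mul_le_mul_right _ hl
    · rw [bits, Nat.testBit_two_pow_mul_add _ hlow]
      split_ifs with hi
      · rw [Nat.testBit_ofBits_lt _ _ hi]; rfl
      · exact h i (not_lt.1 hi)
  · rintro ⟨y, hy⟩
    refine ⟨y / 2 ^ (2 * t), Nat.div_lt_of_lt_mul (y.2.trans_eq (mul_comm _ _)), fun i hi => ?_⟩
    rw [hy i, bits, Nat.testBit_div_two_pow, Nat.sub_add_cancel hi]

variable {X : Type*}

/-- The initial amplitudes. -/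
noncomputable def startAmp (K : ℕ) (C : Matrix (Fin (2 ^ m) × Fin (2 ^ m)) X ℂ) :
    Amp (Nat.clog 2 (2 ^ m)) X := fun p q x =>
  ((1 / Real.sqrt K : ℝ) : ℂ) * C ((bitsEquiv m).symm p, (bitsEquiv m).symm q) x

/-- `Ψ_K` forces both parties to load the same `y`, and the high-order part of `y` is a number below
`L`; this is `Match` with no check done. The factor `1/√K` moves into `startAmp`. -/
lemma loadOp_mul (C : Matrix (Fin (2 ^ m) × Fin (2 ^ m)) X ℂ) :
    (purification m t L u hu hL).loadOp *
      (Matrix.of fun (r : (Fin (2 ^ m) × Fin (2 ^ m)) ×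
        (Fin (L * 2 ^ (2 * t)) × Fin (L * 2 ^ (2 * t)))) x => C r.1 x * maxEnt _ r.2) =
      stage L 0 (fun _ => false) (fun _ => false) (startAmp (L * 2 ^ (2 * t)) C) := by
  ext ⟨a, b⟩ x
  rw [Matrix.mul_apply]
  by_cases hM : Match L 0 (fun _ => false) (fun _ => false) a b
  · obtain ⟨-, h2, h3, h4⟩ := id hM
    obtain ⟨y, hy⟩ := (exists_aux_iff hL fun i => a (auxW i)).1 h4
    have ha : a = (purification m t L u hu hL).load
        ((bitsEquiv m).symm fun j => a (inW j)) y :=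
      (load_eq_iff hu hL _ _ a).2 ⟨by simp, hy, fun z => (h2 z).1⟩
    have hb : b = (purification m t L u hu hL).load
        ((bitsEquiv m).symm fun j => b (inW j)) y :=
      (load_eq_iff hu hL _ _ b).2
        ⟨by simp, fun i => (h3 i (Nat.zero_le _)).symm.trans (hy i), fun z => (h2 z).2⟩
    rw [Finset.sum_eq_single (((bitsEquiv m).symm fun j => a (inW j),
      (bitsEquiv m).symm fun j => b (inW j)), (y, y))]
    · have h1 : (purification m t L u hu hL).loadOp (a, b) (((bitsEquiv m).symm fun j => a (inW j),
          (bitsEquiv m).symm fun j => b (inW j)), (y, y)) = 1 := if_pos (Prod.ext ha hb)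
      rw [h1, one_mul, stage, if_pos hM]
      simp only [Matrix.of_apply, maxEnt, if_true, startAmp]
      rw [mul_comm]
    · rintro ⟨⟨x1, x2⟩, y1, y2⟩ _ hne
      refine mul_eq_zero_of_left (if_neg fun h => hne ?_) _
      obtain ⟨h1, h2⟩ := Prod.mk.inj h
      obtain ⟨h11, h12, -⟩ := (load_eq_iff hu hL _ _ a).1 h1
      obtain ⟨h21, h22, -⟩ := (load_eq_iff hu hL _ _ b).1 h2
      have hK := Nat.le_pow_clog (b := 2) (by norm_num) (L * 2 ^ (2 * t))
      have e1 : y1 = y := Fin.ext (bits_injOn (y1.2.trans_le hK) (y.2.trans_le hK)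
        (funext fun i => (h12 i).symm.trans (hy i)))
      have e2 : y2 = y := Fin.ext (bits_injOn (y2.2.trans_le hK) (y.2.trans_le hK)
        (funext fun i => (h22 i).symm.trans ((h3 i (Nat.zero_le _)).symm.trans (hy i))))
      rw [h11, h21, e1, e2, Equiv.symm_apply_apply, Equiv.symm_apply_apply]
    · simp
  · rw [stage_eq_zero hM]
    refine Finset.sum_eq_zero fun r _ => ?_
    obtain ⟨⟨x1, x2⟩, y1, y2⟩ := r
    by_cases h : (a, b) = ((purification m t L u hu hL).load x1 y1,
        (purification m t L u hu hL).load x2 y2)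
    · by_cases hy : y1 = y2
      · subst hy
        obtain ⟨h1, h2⟩ := Prod.mk.inj h
        obtain ⟨-, h12, h13⟩ := (load_eq_iff hu hL _ _ a).1 h1
        obtain ⟨-, h22, h23⟩ := (load_eq_iff hu hL _ _ b).1 h2
        exact absurd ⟨fun i hi => absurd hi (Nat.not_lt_zero _), fun z => ⟨h13 z, h23 z⟩,
          fun i _ => (h12 i).trans (h22 i).symm, (exists_aux_iff hL _).2 ⟨y1, h12⟩⟩ hM
      · simp [maxEnt, hy]
    · exact mul_eq_zero_of_left (if_neg h) _

variable [Fintype X]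

lemma initial_eq (C : Matrix (Fin (2 ^ m) × Fin (2 ^ m)) X ℂ) :
    (purification m t L u hu hL).initial (C * Cᴴ) =
      stage L 0 (fun _ => false) (fun _ => false) (startAmp (L * 2 ^ (2 * t)) C) *
      (stage L 0 (fun _ => false) (fun _ => false) (startAmp (L * 2 ^ (2 * t)) C))ᴴ := by
  rw [← loadOp_mul hu hL C, Matrix.conjTranspose_mul, Protocol.initial]
  have : (C * Cᴴ) ⊗ₖ Matrix.vecMulVec (maxEnt (L * 2 ^ (2 * t)))
      (star (maxEnt (L * 2 ^ (2 * t)))) =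
      (Matrix.of fun (r : (Fin (2 ^ m) × Fin (2 ^ m)) ×
        (Fin (L * 2 ^ (2 * t)) × Fin (L * 2 ^ (2 * t)))) x => C r.1 x * maxEnt _ r.2) *
      (Matrix.of fun (r : (Fin (2 ^ m) × Fin (2 ^ m)) ×
        (Fin (L * 2 ^ (2 * t)) × Fin (L * 2 ^ (2 * t)))) x => C r.1 x * maxEnt _ r.2)ᴴ := by
    ext r s
    simp only [Matrix.kroneckerMap_apply, Matrix.mul_apply, Matrix.conjTranspose_apply,
      Matrix.vecMulVec_apply, Matrix.of_apply, Pi.star_apply, Finset.sum_mul, star_mul']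
    exact Finset.sum_congr rfl fun x _ => by ring
  rw [this]
  simp only [Matrix.mul_assoc]

lemma normSq_inv_sqrt (K : ℕ) : Complex.normSq ((1 / Real.sqrt K : ℝ) : ℂ) = 1 / K := by
  rw [Complex.normSq_ofReal, div_mul_div_comm, Real.mul_self_sqrt (Nat.cast_nonneg K), one_mul]

lemma normSqAmp_startAmp (K : ℕ) (C : Matrix (Fin (2 ^ m) × Fin (2 ^ m)) X ℂ)
    (hC : (C * Cᴴ).trace = 1) : normSqAmp (startAmp K C) = 1 / K := by
  have h : ∑ r, ∑ x, Complex.normSq (C r x) = 1 := by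
    rw [trace_mul_conjTranspose] at hC
    exact_mod_cast hC
  rw [Fintype.sum_prod_type] at h
  simp only [normSqAmp, startAmp, Complex.normSq_mul, normSq_inv_sqrt, ← Finset.mul_sum]
  rw [Equiv.sum_comp (bitsEquiv m).symm
    fun p => ∑ q, ∑ x, Complex.normSq (C (p, (bitsEquiv m).symm q) x)]
  have : ∀ p, ∑ q, ∑ x, Complex.normSq (C (p, (bitsEquiv m).symm q) x) =
      ∑ q, ∑ x, Complex.normSq (C (p, q) x) := fun p =>
    Equiv.sum_comp (bitsEquiv m).symm fun q => ∑ x, Complex.normSq (C (p, q) x)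
  simp only [this, h, mul_one]

lemma overlap_startAmp (K : ℕ) (C : Matrix (Fin (2 ^ m) × Fin (2 ^ m)) X ℂ) :
    overlap (startAmp K C) / 2 ^ m = fidelity (C * Cᴴ) / K := by
  rw [fidelity_mul_conjTranspose]
  have : ∀ x, ∑ p, C ((bitsEquiv m).symm p, (bitsEquiv m).symm p) x = ∑ y, C (y, y) x :=
    fun x => Equiv.sum_comp (bitsEquiv m).symm fun y => C (y, y) x
  simp only [overlap, startAmp, ← Finset.mul_sum, Complex.normSq_mul, normSq_inv_sqrt, this]
  push_cast
  ring

end Initial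

/-! ### Results of a single branch -/

section Finish

variable {m t L u : ℕ} (hu : u ≤ m) (hL : 0 < L) {X : Type*}

/-- The flag wire has a classical value in every branch, so Alice's final measurement is
deterministic there. -/
lemma proj_mul_stage (α β : Qubits (purification m t L u hu hL).width)
    (χ : Amp (Nat.clog 2 (2 ^ m)) X) (c : Bool) :
    localOp .alice (proj (purification m t L u hu hL).failWire c) 1 * stage L (2 * t) α β χ =
      if α (synW (Fin.last (2 * t))) = c then stage L (2 * t) α β χ else 0 := by
  ext ⟨a, b⟩ x
  rw [localOp_alice_mul_apply, sum_proj _ c (fun a' => stage L (2 * t) α β χ (a', b) x)]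
  by_cases hM : Match L (2 * t) α β a b
  · have := (hM.2.1 (.inr (Fin.last (2 * t)))).1
    change (if a (synW (Fin.last (2 * t))) = c then _ else _) = _
    rw [this]
    split_ifs <;> rfl
  · rw [stage_eq_zero hM]
    split_ifs
    · rw [stage_eq_zero hM]
    · rfl
    · rw [stage_eq_zero hM]
    · rfl

variable [Fintype X]

lemma finish_stage (α β : Qubits (purification m t L u hu hL).width)
    (χ : Amp (Nat.clog 2 (2 ^ m)) X) : ∃ τ,
    (purification m t L u hu hL).finish (stage L (2 * t) α β χ * (stage L (2 * t) α β χ)ᴴ) =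
      [(if α (synW (Fin.last (2 * t))) then L * normSqAmp χ else 0, none),
        (if α (synW (Fin.last (2 * t))) then 0 else L * normSqAmp χ, some τ)] ∧
    (α (synW (Fin.last (2 * t))) = false →
      τ = (stage L (2 * t) α β χ * (stage L (2 * t) α β χ)ᴴ).trace⁻¹ •
        (purification m t L u hu hL).readOut
          (stage L (2 * t) α β χ * (stage L (2 * t) α β χ)ᴴ)) := by
  have hE : ∀ c, localOp .alice (proj (purification m t L u hu hL).failWire c) 1 *
      (stage L (2 * t) α β χ * (stage L (2 * t) α β χ)ᴴ) *
      (localOp .alice (proj (purification m t L u hu hL).failWire c) 1)ᴴ =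
      if α (synW (Fin.last (2 * t))) = c then
        stage L (2 * t) α β χ * (stage L (2 * t) α β χ)ᴴ else 0 := by
    intro c
    rw [← Matrix.mul_assoc, Matrix.mul_assoc _ _ᴴ _ᴴ, ← Matrix.conjTranspose_mul,
      proj_mul_stage]
    split_ifs <;> simp
  have htr := trace_stage (le_two_pow_clog_sub t hL) α β χ
  rcases Bool.eq_false_or_eq_true (α (synW (Fin.last (2 * t)))) with hf | hf
  -- In a failed branch the listed success has probability zero and its state is a junk value,
  -- normalised by `0⁻¹`.
  · refine ⟨(0 : JointOp (purification m t L u hu hL).width).trace⁻¹ •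
      (purification m t L u hu hL).readOut 0, ?_,
      fun h => absurd h (by simp [hf])⟩
    simp only [Protocol.finish, hE, hf, if_true, Bool.true_eq_false, if_false, htr,
      Complex.ofReal_re, Matrix.trace_zero, Complex.zero_re]
  · refine ⟨_, ?_, fun _ => rfl⟩
    simp only [Protocol.finish, hE, hf, if_true, Bool.false_eq_true, if_false, htr,
      Complex.ofReal_re, Matrix.trace_zero, Complex.zero_re]

end Finish

lemma exists_mul_conjTranspose {ι : Type*} [Fintype ι] {ρ : Matrix ι ι ℂ} (hρ : ρ.PosSemidef) :
    ∃ (k : ℕ) (C : Matrix ι (Fin k) ℂ), ρ = C * Cᴴ := by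
  obtain ⟨k, v, hv⟩ := Matrix.posSemidef_iff_eq_sum_vecMulVec.1 hρ
  refine ⟨k, Matrix.of fun r i => v i r, ?_⟩
  rw [hv]
  ext r s
  simp [Matrix.sum_apply, Matrix.mul_apply, Matrix.vecMulVec_apply]

/-! ### Probabilities and expected infidelity after all checks -/

section Weights

variable {m t L : ℕ} {X : Type*} [Fintype X] (C : Matrix (Fin (2 ^ m) × Fin (2 ^ m)) X ℂ)

lemma two_pow_clog (m : ℕ) : (2 : ℝ) ^ Nat.clog 2 (2 ^ m) = 2 ^ m := by
  rw [Nat.clog_pow 2 m (by norm_num)]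

lemma overlap_div_le (χ : Amp (Nat.clog 2 (2 ^ m)) X) : overlap χ / 2 ^ m ≤ normSqAmp χ := by
  have := overlap_le χ
  rw [two_pow_clog] at this
  rwa [div_le_iff₀ (by positivity), mul_comm]

/-- The passing probability. The initial factor `1/K` cancels against the `L` register values and
the `2^(2t)` values of Bob's outcomes. -/
lemma expand_some (hL : 0 < L) (hC : (C * Cᴴ).trace = 1) :
    expand (fun h χ => if h then 0 else L * normSqAmp χ) (2 * t) false
        (startAmp (L * 2 ^ (2 * t)) C) =
      fidelity (C * Cᴴ) + (1 - fidelity (C * Cᴴ)) / 2 ^ (2 * t) := by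
  have h1 : (fun (h : Bool) (χ : Amp (Nat.clog 2 (2 ^ m)) X) =>
      if h then (0 : ℝ) else L * normSqAmp χ) =
      fun h χ => (L : ℝ) * if h then 0 else normSqAmp χ := by
    ext h χ; cases h <;> simp
  have hL' : (L : ℝ) ≠ 0 := by exact_mod_cast hL.ne'
  have ho := overlap_startAmp (L * 2 ^ (2 * t)) C
  rw [h1, expand_const_mul, expand_passed_normSqAmp, normSqAmp_startAmp _ _ hC]
  rw [two_pow_clog, ho]
  push_cast
  field_simp
  ring

lemma expand_total (hL : 0 < L) (hC : (C * Cᴴ).trace = 1) :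
    expand (fun _ χ => L * normSqAmp χ) (2 * t) false (startAmp (L * 2 ^ (2 * t)) C) = 1 := by
  have hL' : (L : ℝ) ≠ 0 := by exact_mod_cast hL.ne'
  rw [expand_const_mul, expand_normSqAmp, normSqAmp_startAmp _ _ hC]
  push_cast
  field_simp

/-- The expectation to which Markov's inequality is applied: the orthogonal weight that survives all
`2t` checks. -/
lemma expand_deficit (hL : 0 < L) (hC : (C * Cᴴ).trace = 1) :
    expand (fun h χ => if h then 0 else L * (normSqAmp χ - overlap χ / 2 ^ m)) (2 * t) false
        (startAmp (L * 2 ^ (2 * t)) C) = (1 - fidelity (C * Cᴴ)) / 2 ^ (2 * t) := by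
  have h1 : (fun (h : Bool) (χ : Amp (Nat.clog 2 (2 ^ m)) X) =>
      if h then (0 : ℝ) else L * (normSqAmp χ - overlap χ / 2 ^ m)) =
      fun h χ => (if h then 0 else L * normSqAmp χ) -
        (L / 2 ^ m : ℝ) * if h then 0 else overlap χ := by
    ext h χ; cases h <;> simp; ring
  have hL' : (L : ℝ) ≠ 0 := by exact_mod_cast hL.ne'
  have ho := overlap_startAmp (L * 2 ^ (2 * t)) C
  rw [h1, expand_sub, expand_some C hL hC, expand_const_mul, expand_passed_overlap]
  have : (L / 2 ^ m : ℝ) * (2 ^ (2 * t) * overlap (startAmp (L * 2 ^ (2 * t)) C)) =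
      L * 2 ^ (2 * t) * (overlap (startAmp (L * 2 ^ (2 * t)) C) / 2 ^ m) := by ring
  rw [this, ho]
  push_cast
  field_simp
  ring

lemma fidelity_le_one (hC : (C * Cᴴ).trace = 1) : fidelity (C * Cᴴ) ≤ 1 := by
  have h := overlap_div_le (startAmp 1 C)
  rw [overlap_startAmp, normSqAmp_startAmp _ _ hC] at h
  simpa using h

end Weights

/-! ### Success of the protocol -/

section Success

variable {m t L u : ℕ} (hu : u ≤ m) (hL : 0 < L) {X : Type*} [Fintype X]

/-- The probability of an event in one branch. -/
noncomputable def branchProb {N K M : ℕ} (P : Protocol N K M)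
    (E : Option (Matrix (Fin M × Fin M) (Fin M × Fin M) ℂ) → Prop) (σ : JointOp P.width) : ℝ :=
  open Classical in ((P.finish σ).map fun r => if E r.2 then r.1 else 0).sum

lemma prob_eq_total (C : Matrix (Fin (2 ^ m) × Fin (2 ^ m)) X ℂ)
    (E : Option (Matrix (Fin (2 ^ u * L) × Fin (2 ^ u * L)) (Fin (2 ^ u * L) × Fin (2 ^ u * L)) ℂ)
      → Prop) :
    (purification m t L u hu hL).prob (C * Cᴴ) E =
      total (checks (two_mul_le_clog t hL))
        (stage L 0 (fun _ => false) (fun _ => false) (startAmp (L * 2 ^ (2 * t)) C))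
        (branchProb (purification m t L u hu hL) E) := by
  rw [Protocol.prob, Protocol.results, initial_eq, total]
  change _ = (List.map _ (branches (purification m t L u hu hL).program _)).sum
  induction branches (purification m t L u hu hL).program _ with
  | nil => rfl
  | cons σ l ih =>
    rw [List.flatMap_cons, List.map_append, List.sum_append, ih, List.map_cons, List.sum_cons]
    rfl

lemma isState_stage (α β : Qubits (purification m t L u hu hL).width)
    (χ : Amp (Nat.clog 2 (2 ^ m)) X) (h0 : L * normSqAmp χ ≠ 0) :
    IsState ((stage L (2 * t) α β χ * (stage L (2 * t) α β χ)ᴴ).trace⁻¹ •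
      (purification m t L u hu hL).readOut
        (stage L (2 * t) α β χ * (stage L (2 * t) α β χ)ᴴ)) := by
  have htr := trace_stage (le_two_pow_clog_sub t hL) α β χ
  have hne : (stage L (2 * t) α β χ * (stage L (2 * t) α β χ)ᴴ).trace.re ≠ 0 := by
    rw [htr, Complex.ofReal_re]
    exact h0
  exact Protocol.isState_readOut (purification m t L u hu hL) (stage L (2 * t) α β χ)
    (reads_of_stage_ne_zero hu hL α β χ) hne

lemma isGEPP_purification : (purification m t L u hu hL).IsGEPP := by
  classical
  intro ρ hρ r hr hr1 τ hτ
  obtain ⟨k, C, rfl⟩ := exists_mul_conjTranspose hρ.1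
  obtain ⟨σ, hσ, hrσ⟩ := List.mem_flatMap.1 hr
  -- An indicator of bad branches with values in `ℕ`: if its total vanishes, then no branch is bad.
  let Φ : JointOp (purification m t L u hu hL).width → ℕ := fun σ =>
    if ∀ r ∈ (purification m t L u hu hL).finish σ, r.1 ≠ 0 → ∀ τ, r.2 = some τ → IsState τ
    then 0 else 1
  have hstage : ∀ (α α' : Qubits (purification m t L u hu hL).width)
      (χ : Amp (Nat.clog 2 (2 ^ m)) (Fin k)),
      Φ (stage L (2 * t) α α' χ * (stage L (2 * t) α α' χ)ᴴ) = 0 := by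
    intro α α' χ
    refine if_pos ?_
    obtain ⟨τ', hfin, hτ'⟩ := finish_stage hu hL α α' χ
    intro r hr hr1 τ hτ
    rw [hfin] at hr
    rcases List.mem_cons.1 hr with rfl | hr
    · exact absurd hτ (by simp)
    · obtain rfl := List.mem_singleton.1 hr
      have hf : α (synW (Fin.last (2 * t))) = false := by
        by_contra h
        rw [Bool.not_eq_false] at h
        simp [h] at hr1
      have h0 : L * normSqAmp χ ≠ 0 := by simpa only [hf, Bool.false_eq_true, if_false] using hr1
      rw [← Option.some.inj hτ, hτ' hf]
      exact isState_stage hu hL α α' χ h0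
  have h0 := total_checks (R := Eq) rfl (fun _ _ _ _ h h' => by rw [h, h'])
    (two_mul_le_clog t hL) L Φ (fun _ _ => 0) hstage (startAmp (L * 2 ^ (2 * t)) C)
  rw [expand_zero_fun, total, ← initial_eq hu hL] at h0
  have h1 : Φ σ = 0 := List.sum_eq_zero_iff.1 h0 _ (List.mem_map_of_mem hσ)
  by_contra hcon
  have : Φ σ = 1 := if_neg fun h => hcon (h r hrσ hr1 τ hτ)
  omega

variable (C : Matrix (Fin (2 ^ m) × Fin (2 ^ m)) X ℂ)

lemma prob_none :
    (purification m t L u hu hL).prob (C * Cᴴ) (fun r => r = none) =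
      expand (fun h χ => L * normSqAmp χ - if h then 0 else L * normSqAmp χ) (2 * t) false
        (startAmp (L * 2 ^ (2 * t)) C) := by
  rw [prob_eq_total]
  refine total_checks (R := Eq) rfl (fun _ _ _ _ h h' => by rw [h, h']) _ L _ _ ?_ _
  intro α α' χ
  obtain ⟨τ, hfin, -⟩ := finish_stage hu hL α α' χ
  rw [branchProb, hfin]
  cases α (synW (Fin.last (2 * t))) <;> simp

lemma prob_ne_none :
    (purification m t L u hu hL).prob (C * Cᴴ) (fun r => r ≠ none) =
      expand (fun h χ => if h then 0 else L * normSqAmp χ) (2 * t) false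
        (startAmp (L * 2 ^ (2 * t)) C) := by
  rw [prob_eq_total]
  refine total_checks (R := Eq) rfl (fun _ _ _ _ h h' => by rw [h, h']) _ L _ _ ?_ _
  intro α α' χ
  obtain ⟨τ, hfin, -⟩ := finish_stage hu hL α α' χ
  rw [branchProb, hfin]
  cases α (synW (Fin.last (2 * t))) <;> simp

open Classical in
-- A passed branch is counted on the left only if the overlap of `χ` already certifies the fidelity.
-- This is just an inequality because discarding wires may raise the fidelity.
lemma le_prob_good (δ : ℝ) :
    expand (fun h χ => (if h then 0 else L * normSqAmp χ) -
        if h then 0 else if (1 - δ) * normSqAmp χ ≤ overlap χ / 2 ^ m then 0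
          else L * normSqAmp χ) (2 * t) false (startAmp (L * 2 ^ (2 * t)) C) ≤
      (purification m t L u hu hL).prob (C * Cᴴ) (fun r => ∃ τ, r = some τ ∧ 1 - δ ≤ fidelity τ) := by
  rw [prob_eq_total]
  refine total_checks (R := fun a b => b ≤ a) le_rfl (fun _ _ _ _ h h' => add_le_add h h') _ L _ _
    ?_ _
  intro α α' χ
  obtain ⟨τ, hfin, hτ⟩ := finish_stage hu hL α α' χ
  rw [branchProb, hfin]
  have hnn : 0 ≤ L * normSqAmp χ := mul_nonneg (Nat.cast_nonneg L) (normSqAmp_nonneg χ)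
  cases hf : α (synW (Fin.last (2 * t)))
  swap
  · simp
  simp only [Bool.false_eq_true, if_false, List.map_cons, List.map_nil, List.sum_cons,
    List.sum_nil, reduceCtorEq, false_and, exists_false, zero_add, add_zero, Option.some.injEq,
    exists_eq_left']
  by_cases hgood : (1 - δ) * normSqAmp χ ≤ overlap χ / 2 ^ m
  swap
  · rw [if_neg hgood, sub_self]
    split_ifs <;> simp [hnn]
  rw [if_pos hgood, sub_zero]
  rcases (normSqAmp_nonneg χ).eq_or_lt with h0 | h0
  · simp [← h0]
  rw [if_pos]
  rw [hτ hf, trace_stage (le_two_pow_clog_sub t hL), ← Complex.ofReal_inv, fidelity_real_smul]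
  have hL' : (0 : ℝ) < L := by exact_mod_cast hL
  have h := fidelity_readOut_stage hu hL α α' χ
  rw [inv_mul_eq_div, le_div_iff₀ (by positivity)]
  calc (1 - δ) * (L * normSqAmp χ) = L * ((1 - δ) * normSqAmp χ) := by ring
    _ ≤ L * (overlap χ / 2 ^ m) := by gcongr
    _ ≤ _ := h

/-- Markov's inequality for the infidelity of the output. -/
lemma probSuccessful_purification {ε : ℝ} (hε : ε < 1 / 2) :
    (purification m t L u hu hL).ProbSuccessful ε (ε / (2 : ℝ) ^ ((t : ℤ) - 3))
      (2 * ε + Real.sqrt (2 * ε / 2 ^ t)) (1 / 2 ^ t) := by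
  classical
  refine ⟨isGEPP_purification hu hL, fun ρ hρ hF => ?_⟩
  obtain ⟨k, C, rfl⟩ := exists_mul_conjTranspose hρ.1
  have hC := hρ.2
  have hF1 := fidelity_le_one C hC
  have hε0 : 0 ≤ ε := by linarith
  have hsome := expand_some (t := t) C hL hC
  have hdef := expand_deficit (t := t) C hL hC
  set δ : ℝ := ε / (2 : ℝ) ^ ((t : ℤ) - 3) with hδ
  have hδ8 : δ = 8 * ε / 2 ^ t := by
    rw [hδ, zpow_sub₀ (by norm_num)]
    norm_num
    ring
  have hδ0 : 0 ≤ δ := by rw [hδ8]; positivity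
  have hgood := le_prob_good (t := t) hu hL C δ
  rw [prob_none, prob_ne_none, expand_sub, expand_total C hL hC]
  rw [expand_sub] at hgood
  set F := fidelity (C * Cᴴ)
  have h2t : (2 : ℝ) ^ (2 * t) = 2 ^ t * 2 ^ t := by rw [two_mul, pow_add]
  have hpos : (0 : ℝ) < 2 ^ t := by positivity
  have hrest : 0 ≤ (1 - F) / 2 ^ (2 * t) := div_nonneg (by linarith) (by positivity)
  constructor
  · rw [hsome]
    have := Real.sqrt_nonneg (2 * ε / 2 ^ t)
    linarith
  refine le_trans ?_ hgood
  rw [hsome]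
  set bad := expand (fun h χ => if h then 0 else
    if (1 - δ) * normSqAmp χ ≤ overlap χ / 2 ^ m then 0 else L * normSqAmp χ) (2 * t) false
      (startAmp (L * 2 ^ (2 * t)) C) with hbad
  have hLr : (0 : ℝ) ≤ L := Nat.cast_nonneg L
  have hdnn : ∀ (h : Bool) (χ : Amp (Nat.clog 2 (2 ^ m)) (Fin k)),
      0 ≤ if h then 0 else L * (normSqAmp χ - overlap χ / 2 ^ m) := by
    intro h χ
    cases h
    · exact mul_nonneg hLr (sub_nonneg.2 (overlap_div_le χ))
    · exact le_rfl
  -- The second factor is the passing probability, so this is the conditional bound multiplied out.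
  suffices hb : bad ≤ 1 / 2 ^ t * (F + (1 - F) / 2 ^ (2 * t)) by linarith
  have hFhalf : 1 / 2 ≤ F + (1 - F) / 2 ^ (2 * t) := by linarith
  -- For `ε = 0` the threshold `δ` is zero and cannot be divided by; then `F = 1`, and a vanishing
  -- expected infidelity vanishes in every branch.
  rcases hε0.eq_or_lt with h0 | h0
  · have hF0 : F = 1 := by linarith
    have : bad = 0 := by
      refine expand_eq_zero hdnn (fun h χ hz => ?_) _ _ _ (hdef.trans (by rw [hF0]; simp))
      cases h
      · simp only [Bool.false_eq_true, if_false] at hz ⊢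
        rcases mul_eq_zero.1 hz with hz | hz
        · simp [hz]
        · refine if_pos ?_
          have := mul_nonneg hδ0 (normSqAmp_nonneg χ)
          linarith
      · rfl
    rw [this]
    positivity
  · have hmarkov : δ * bad ≤ (1 - F) / 2 ^ (2 * t) := by
      rw [← hdef, hbad, ← expand_const_mul]
      refine expand_mono (fun h χ => ?_) _ _ _
      cases h
      · have h1 := hdnn false χ
        simp only [Bool.false_eq_true, if_false] at h1 ⊢
        split_ifs with hg
        · simpa using h1
        · have : L * (δ * normSqAmp χ) ≤ L * (normSqAmp χ - overlap χ / 2 ^ m) :=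
            mul_le_mul_of_nonneg_left (by linarith) hLr
          linarith
      · simp
    have h3 : 8 * ε / 2 ^ t * bad ≤ ε / (2 ^ t * 2 ^ t) := by
      rw [← hδ8, ← h2t]
      refine hmarkov.trans ?_
      gcongr
      linarith
    -- The `8` is the `2^3` in `δ = ε / 2^(t-3)`; as passing has probability at least `1/2`, a
    -- factor `4` is to spare.
    have h4 : bad ≤ 1 / 8 * (1 / 2 ^ t) := by
      have h5 : 8 * ε / 2 ^ t * bad ≤ 8 * ε / 2 ^ t * (1 / 8 * (1 / 2 ^ t)) := by
        refine h3.trans (le_of_eq ?_)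
        field_simp
      exact le_of_mul_le_mul_left h5 (by positivity)
    have h6 : (0 : ℝ) < 1 / 2 ^ t := by positivity
    nlinarith

end Success

/-! ### Circuit size -/

section Size

lemma length_check {nI nK T : ℕ} (hT : T ≤ nK) (k : Fin T) :
    (check hT k : List (Step (numWires nI nK T))).length = 8 * nI + 7 := by
  simp only [check, sample, both, List.length_append, List.length_flatMap, List.length_cons,
    List.length_nil, List.map_const', List.length_finRange, List.sum_replicate, smul_eq_mul]
  ring

lemma length_checks {nI nK T : ℕ} (hT : T ≤ nK) :
    (checks hT : List (Step (numWires nI nK T))).length = T * (8 * nI + 7) := by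
  simp [checks, List.length_flatMap, length_check]

/-- There are `2t` checks, each with `8m + 7` steps and `2m` random wires per party, so the leading
term is `24tm`. It and the linear terms are absorbed by the square of `m + log L + 2t ≥ 1`; the
constant `31` is generous. -/
lemma sizeBound_purification {m t L u : ℕ} (hm : 1 ≤ m) (hu : u ≤ m) (hL : 0 < L) :
    SizeBound (purification m t L u hu hL) 31 2 := by
  have hL1 : (1 : ℝ) ≤ L := by exact_mod_cast hL
  have hlog : 0 ≤ Real.logb 2 L := Real.logb_nonneg (by norm_num) hL1
  have hclog : (Nat.clog 2 L : ℝ) ≤ Real.logb 2 L + 1 := by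
    have h := Real.natCeil_logb_natCast 2 L
    rw [← h]
    exact_mod_cast (Nat.ceil_lt_add_one hlog).le
  have hN : Real.logb 2 ((2 ^ m : ℕ) : ℝ) = m := by
    push_cast
    rw [Real.logb_pow, Real.logb_self_eq_one (by norm_num), mul_one]
  have hK : Real.logb 2 ((L * 2 ^ (2 * t) : ℕ) : ℝ) = Real.logb 2 L + 2 * t := by
    push_cast
    rw [Real.logb_mul (by positivity) (by positivity), Real.logb_pow,
      Real.logb_self_eq_one (by norm_num)]
    push_cast
    ring
  have hsize : (purification m t L u hu hL).size =
      2 * t * (8 * m + 7) + 2 * (m + (2 * t + Nat.clog 2 L) + (2 * t * m + 2 * t * m + (2 * t + 1))) := by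
    change (checks (two_mul_le_clog t hL)).length + 2 * numWires _ _ _ = _
    rw [length_checks]
    simp only [numWires, Fintype.card_sum, Fintype.card_prod, Fintype.card_fin]
    rw [clog_aux t hL, Nat.clog_pow 2 m (by norm_num)]
  unfold SizeBound
  rw [hsize, hN, hK]
  push_cast
  have hm' : (1 : ℝ) ≤ m := by exact_mod_cast hm
  have ht : (0 : ℝ) ≤ t := Nat.cast_nonneg t
  set S : ℝ := m + (Real.logb 2 L + 2 * t) with hS
  have hS1 : 1 ≤ S := by linarith
  have h1 : (2 * t : ℝ) * m ≤ S ^ 2 := by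
    rw [sq]
    exact mul_le_mul (by linarith) (by linarith) (by linarith) (by linarith)
  have h2 : S ≤ S ^ 2 := by nlinarith
  nlinarith

end Size

theorem theorem3 :
    (∃ C c : ℕ, ∀ n t : ℕ, t < n → ∀ ε : ℝ, ε < 1 / 2 →
      ∃ P : Protocol (2 ^ n) ((2 ^ n - 1) * 2 ^ (2 * t)) (2 ^ (n - t) * (2 ^ n - 1)),
        SizeBound P C c ∧
        P.ProbSuccessful ε (ε / (2 : ℝ) ^ ((t : ℤ) - 3))
          (2 * ε + Real.sqrt (2 * ε / 2 ^ t)) (1 / 2 ^ t)) ∧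
    (∃ C c : ℕ, ∀ n t : ℕ, t < n → ∀ ε : ℝ, ε < 1 / 2 →
      ∃ P : Protocol (2 ^ (2 * n)) ((2 ^ n + 1) * 2 ^ (2 * t)) (2 ^ n * (2 ^ n + 1)),
        SizeBound P C c ∧
        P.ProbSuccessful ε (ε / (2 : ℝ) ^ ((t : ℤ) - 3))
          (2 * ε + Real.sqrt (2 * ε / 2 ^ t)) (1 / 2 ^ t)) ∧
    (∃ C c : ℕ, ∀ n t d : ℕ, t < n → 1 ≤ d → ∀ ε : ℝ, ε < 1 / 2 →
      ∃ P : Protocol (2 ^ (d * n)) ((2 ^ (d * n) - 1) / (2 ^ n - 1) * 2 ^ (2 * t))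
          (2 ^ ((d - 1) * n) * ((2 ^ (d * n) - 1) / (2 ^ n - 1))),
        SizeBound P C c ∧
        P.ProbSuccessful ε (ε / (2 : ℝ) ^ ((t : ℤ) - 3))
          (2 * ε + Real.sqrt (2 * ε / 2 ^ t)) (1 / 2 ^ t)) := by
  have hpos : ∀ n t : ℕ, t < n → 0 < 2 ^ n - 1 := fun n t htn =>
    Nat.sub_pos_of_lt (Nat.one_lt_two_pow (by omega))
  refine ⟨⟨31, 2, fun n t htn ε hε => ?_⟩, ⟨31, 2, fun n t htn ε hε => ?_⟩,
    ⟨31, 2, fun n t d htn hd ε hε => ?_⟩⟩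
  · exact ⟨purification n t (2 ^ n - 1) (n - t) (Nat.sub_le n t) (hpos n t htn),
      sizeBound_purification (by omega) _ _, probSuccessful_purification _ _ hε⟩
  · exact ⟨purification (2 * n) t (2 ^ n + 1) n (by omega) (Nat.succ_pos _),
      sizeBound_purification (by omega) _ _, probSuccessful_purification _ _ hε⟩
  · have hn : n ≤ d * n := Nat.le_mul_of_pos_left n hd
    -- The quotient is a natural-number division, which is exact, but the protocol only needs `L` to
    -- be positive.
    have hL : 0 < (2 ^ (d * n) - 1) / (2 ^ n - 1) :=
      Nat.div_pos (Nat.sub_le_sub_right (Nat.pow_le_pow_right (by norm_num) hn) 1) (hpos n t htn)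
    exact ⟨purification (d * n) t _ ((d - 1) * n) (Nat.mul_le_mul_right n (Nat.sub_le d 1)) hL,
      sizeBound_purification (by omega) _ _, probSuccessful_purification _ _ hε⟩
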